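/- **Setting.** Let $P$ be a finite unit interval order, i.e. a finite poset on a set $V$ that is $(2+2)$-free and $(3+1)$-free, and let $G$ be its incomparability graph (vertex set $V$; $u,v$ adjacent iff they are incomparable in $P$). Fix a total order $<$ on $V$ that is a natural labelling of $P$: $u<_P v$ implies $u<v$, and if $u<_P w$ and $v$ is incomparable in $P$ to both $u$ and $w$, then $u<v<w$. (Such a total order always exists; it is the left-to-right order of the unit intervals.) A *proper set coloring* $\kappa$ assigns to each vertex a nonempty finite set of positive integers such that adjacent vertices get disjoint sets; $\operatorname{asc}(\kappa)$ is the number of quadruples $(u,v,i,j)$ with $u,v$ adjacent, $u<v$, $i\in\kappa(u)$, $j\in\kappa(v)$, $i<j$. The Kromatic quasisymmetric function is $$\overline X_G(q)=\sum_{\kappa}q^{\operatorname{asc}(\kappa)}\prod_{v\in V}\prod_{i\in\kappa(v)}x_i\in\mathbb{Q}[q][[x_1,x_2,\dots]].$$ On symmetric power series, $\omega$ is given by $\omega\big(\sum_\lambda c_\lambda p_\lambda\big)=\sum_\lambda(-1)^{|\lambda|-\ell(\lambda)}c_\lambda p_\lambda$, where $p_\lambda$ are the power sums. For $k\ge1$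 let $1+\overline p'_k=\prod_{i\ge1}(1+x_i^k+x_i^{2k}+\cdots)$, and $\overline p'_\lambda=\prod_i\overline p'_{\lambda_i}$. Let $z_\lambda=\prod_k k^{i_k}i_k!$, where $i_k$ is the number of parts of $\lambda$ equal to $k$, and let $\mu$ be the Möbius function. A *heap* on $G$ is an equivalence class of words in the alphabet $V$ under exchanging consecutive distinct nonadjacent letters; its letters are its *pieces*, its size is the number of pieces, and composition $\circ$ is concatenation. Two pieces from equal or adjacent vertices are joined by an edge directed from the earlier to the later piece. A *pyramid* is a heap with a unique source (piece with no incoming edge). For a partition $\lambda$, $\mathcal P_G^{\mathrm{all}\,V}(\lambda)$ is the set of lists $(P_1,\dots,P_{\ell(\lambda)})$ of pyramids with $|P_i|=\lambda_i$ that together use every vertex of $G$, and $\operatorname{asc}(P)$ is the number of edges in $P_1\circ\cdots\circ P_{\ell(\lambda)}$ directed from a piece of a vertex $u$ to a piece of a vertex $v$ with $u<v$. **Statement.** The series $\overline X_G(q)$ is symmetric, $$\omega(\overline X_G(q))=\sum_\lambda\frac1{z_\lambda}\sum_{P\in\mathcal P_G^{\mathrm{all}\,V}(\lambda)}q^{\operatorname{asc}(P)}\prod_{i=1}^{\ell(\lambda)}\sum_{d\ge1}\frac{\mu(d)}{d}\ln(1+\overline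 p'_{d\lambda_i}),$$ the sum being over all integer partitions $\lambda$, and $\omega(\overline X_G(q))$ has a unique expansion $\sum_\lambda c_\lambda\,\overline p'_\lambda$ with $c_\lambda\in\mathbb{Q}[q]$; its coefficients are $$c_\lambda=\sum_{(d\lambda')^n=\lambda}\frac1{z_{\lambda'}}\sum_{P\in\mathcal P_G^{\mathrm{all}\,V}(\lambda')}q^{\operatorname{asc}(P)}\prod_{i=1}^{\ell(\lambda')}\frac{\mu(d_i)(-1)^{n_i+1}}{d_in_i}.$$ Here the sum is over all triples $(\lambda',d,n)$ of a partition $\lambda'$ and sequences $d,n$ of $\ell(\lambda')$ positive integers such that $(d\lambda')^n=\lambda$, where $(d\lambda')^n$ is the partition whose parts are $d_i\lambda'_i$ repeated $n_i$ times, for all $i$. -/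

import Mathlib

namespace Kromatic

noncomputable section

/-! ### Unit interval orders and their incomparability graphs -/

section Posets

variable {V : Type*}

/-- `P` is `(a + b)`-free: there are no chains `v₁ < ⋯ < v_a` and `w₁ < ⋯ < w_b` in `P` such that
every `vᵢ` is incomparable to every `wⱼ`. -/
def IsSumFree (P : PartialOrder V) (a b : ℕ) : Prop :=
  ¬ ∃ (v : Fin a → V) (w : Fin b → V),
    (∀ i j, i < j → P.lt (v i) (v j)) ∧ (∀ i j, i < j → P.lt (w i) (w j)) ∧
      ∀ i j, IncompRel P.le (v i) (w j)

/-- A unit interval order is a poset that is `(2 + 2)`-free and `(3 + 1)`-free. -/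
def IsUnitIntervalOrder (P : PartialOrder V) : Prop :=
  IsSumFree P 2 2 ∧ IsSumFree P 3 1

/-- The fixed total order on `V` is a natural labelling of the unit interval order `P`: it
extends `P`, and it puts an element incomparable to both `u` and `w`, where `u <_P w`,
between `u` and `w`. (Equivalently, the total order is the left-to-right order of the
unit intervals.) -/
def IsNaturalLabelling [L : LinearOrder V] (P : PartialOrder V) : Prop :=
  (∀ u v, P.lt u v → L.lt u v) ∧
    ∀ u v w, P.lt u w → IncompRel P.le v u → IncompRel P.le v w → L.lt u v ∧ L.lt v w

/-- The incomparability graph of a poset. -/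
def incompGraph (P : PartialOrder V) : SimpleGraph V where
  Adj u v := IncompRel P.le u v
  symm := ⟨fun _ _ h => ⟨h.2, h.1⟩⟩
  loopless := ⟨fun u h => h.1 (P.le_refl u)⟩

end Posets

/-! ### Formal power series in `x₀, x₁, x₂, …` with coefficients in `ℚ[q]` -/

/-- Formal power series in countably many variables over `ℚ[q]`; `q` is `Polynomial.X`. -/
abbrev Series : Type := MvPowerSeries ℕ (Polynomial ℚ)

/-- Every monomial occurs in only finitely many members of the family. -/
def FormalSummable {ι : Type*} (f : ι → Series) : Prop :=
  ∀ m, {i | MvPowerSeries.coeff m (f i) ≠ 0}.Finite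

/-- The sum of a (formally summable) family of power series, coefficient by coefficient. -/
def formalSum {ι : Type*} (f : ι → Series) : Series :=
  fun m => ∑ᶠ i, MvPowerSeries.coeff m (f i)

/-- The family `f` of power series is formally summable, with sum `g`. -/
def FormalHasSum {ι : Type*} (f : ι → Series) (g : Series) : Prop :=
  FormalSummable f ∧ g = formalSum f

/-- Invariance under all permutations of the variables. -/
def IsSymmetricSeries (f : Series) : Prop :=
  ∀ (e : Equiv.Perm ℕ) (m : ℕ →₀ ℕ),
    MvPowerSeries.coeff (m.mapDomain e) f = MvPowerSeries.coeff m f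

/-! ### Partitions -/

/-- Integer partitions of arbitrary size. -/
abbrev Ptn : Type := Σ n : ℕ, n.Partition

/-- The parts `λ₁ ≥ λ₂ ≥ ⋯` as a list. -/
def Ptn.rows (lam : Ptn) : List ℕ := lam.2.parts.sort (· ≥ ·)

/-- The length `ℓ(λ)`. -/
def Ptn.length (lam : Ptn) : ℕ := lam.rows.length

/-- The `i`-th part of `λ`. -/
def Ptn.row (lam : Ptn) (i : Fin lam.length) : ℕ := lam.rows.get i

/-- `z_λ = ∏ₖ k ^ iₖ(λ) * iₖ(λ)!`, where `iₖ(λ)` is the multiplicity of `k` in `λ`. -/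
def Ptn.z (lam : Ptn) : ℕ :=
  ∏ k ∈ lam.2.parts.toFinset, k ^ lam.2.parts.count k * (lam.2.parts.count k).factorial

/-! ### Power sums and the involution `ω` -/

open Classical in
/-- The power sum `p_k = ∑ᵢ xᵢ ^ k` (for `k ≥ 1`). -/
def psum (k : ℕ) : Series := fun m => if ∃ i, m = Finsupp.single i k then 1 else 0

/-- `p_λ = ∏ᵢ p_{λᵢ}`. -/
def psumPtn (lam : Ptn) : Series := ∏ i, psum (lam.row i)

/-- The symmetric power series `f` has the power sum expansion `f = ∑_λ c_λ p_λ`. -/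
def IsPsumExpansion (c : Ptn → Polynomial ℚ) (f : Series) : Prop :=
  FormalHasSum (fun lam => c lam • psumPtn lam) f


theorem Ptn.map_row (lam : Ptn) : (Finset.univ.val.map lam.row : Multiset ℕ) = lam.2.parts := by
  have h : (Finset.univ.val.map lam.row : Multiset ℕ) = (lam.rows : Multiset ℕ) := by
    have := List.ofFn_get lam.rows
    conv_rhs => rw [← this]
    rw [← Fin.univ_val_map]
    rfl
  rw [h, Ptn.rows, Multiset.sort_eq]

theorem Ptn.row_pos (lam : Ptn) (i : Fin lam.length) : 0 < lam.row i := by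
  apply lam.2.parts_pos
  rw [← lam.map_row]
  exact Multiset.mem_map_of_mem _ (Finset.mem_univ i)

theorem coeff_psumPtn_ne_zero_iff (lam : Ptn) (m : ℕ →₀ ℕ) :
    MvPowerSeries.coeff m (psumPtn lam) ≠ 0 ↔
      ∃ f : Fin lam.length → ℕ, m = ∑ i, Finsupp.single (f i) (lam.row i) := by
  classical
  rw [psumPtn, MvPowerSeries.coeff_prod]
  have h1 : ∀ l : Fin lam.length →₀ (ℕ →₀ ℕ),
      ∏ i, MvPowerSeries.coeff (l i) (psum (lam.row i)) =
        (((if ∀ i, ∃ j, l i = Finsupp.single j (lam.row i) then 1 else 0 : ℕ)) :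
          Polynomial ℚ) := by
    intro l
    have h2 : ∀ i, MvPowerSeries.coeff (l i) (psum (lam.row i)) =
        if ∃ j, l i = Finsupp.single j (lam.row i) then 1 else 0 := fun i => rfl
    simp_rw [h2]
    rw [Finset.prod_ite_zero]
    simp
  simp_rw [h1]
  rw [← Nat.cast_sum, Nat.cast_ne_zero, ← Nat.pos_iff_ne_zero, Finset.sum_pos_iff]
  constructor
  · rintro ⟨l, hl, hpos⟩
    have hl2 : ∀ i, ∃ j, l i = Finsupp.single j (lam.row i) := by
      by_contra hcon
      simp [hcon] at hpos
    choose f hf using hl2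
    refine ⟨f, ?_⟩
    rw [Finset.mem_finsuppAntidiag] at hl
    rw [← hl.1]
    exact Finset.sum_congr rfl fun i _ => hf i
  · rintro ⟨f, hf⟩
    refine ⟨Finsupp.equivFunOnFinite.symm fun i => Finsupp.single (f i) (lam.row i), ?_, ?_⟩
    · rw [Finset.mem_finsuppAntidiag]
      exact ⟨by simpa using hf.symm, Finset.subset_univ _⟩
    · rw [if_pos]
      · exact one_pos
      · exact fun i => ⟨f i, by simp⟩

theorem values_eq_parts (lam : Ptn) (f : Fin lam.length → ℕ) (hf : Function.Injective f)
    (m : ℕ →₀ ℕ) (hm : m = ∑ i, Finsupp.single (f i) (lam.row i)) :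
    m.support.val.map m = lam.2.parts := by
  classical
  subst hm
  have hval : ∀ i, (∑ i, Finsupp.single (f i) (lam.row i)) (f i) = lam.row i := by
    intro i
    rw [Finsupp.finsetSum_apply, Finset.sum_eq_single i]
    · simp
    · intro j _ hj
      exact Finsupp.single_eq_of_ne (fun h => hj (hf h.symm))
    · simp
  have hsupp : (∑ i, Finsupp.single (f i) (lam.row i)).support = Finset.univ.image f := by
    ext x
    rw [Finsupp.mem_support_iff, Finset.mem_image]
    constructor
    · intro hx
      by_contra hcon
      apply hx
      rw [Finsupp.finsetSum_apply]
      refine Finset.sum_eq_zero fun j _ => Finsupp.single_eq_of_ne fun h => hcon ⟨j, by simp, h.symm⟩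
    · rintro ⟨i, _, rfl⟩
      rw [hval]
      exact (lam.row_pos i).ne'
  rw [hsupp, Finset.image_val_of_injOn hf.injOn, Multiset.map_map, ← lam.map_row]
  exact Multiset.map_congr rfl fun i _ => hval i

theorem Ptn.sum_row (lam : Ptn) : ∑ i, lam.row i = lam.1 := by
  rw [← lam.2.parts_sum, ← lam.map_row]
  rfl

theorem Ptn.length_le (lam : Ptn) : lam.length ≤ lam.1 := by
  rw [← lam.sum_row]
  have h := Finset.sum_le_sum fun i (_ : i ∈ Finset.univ) => Nat.succ_le_of_lt (lam.row_pos i)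
  simpa using h

theorem Ptn.ext_parts {lam nu : Ptn} (h : lam.2.parts = nu.2.parts) : lam = nu := by
  obtain ⟨n, p⟩ := lam
  obtain ⟨k, q⟩ := nu
  have hnk : n = k := by rw [← p.parts_sum, ← q.parts_sum]; exact congrArg Multiset.sum h
  subst hnk
  exact congrArg _ (Nat.Partition.ext h)

/-- The power sum coefficients of a symmetric power series are unique. -/
theorem isPsumExpansion_unique {c c' : Ptn → Polynomial ℚ} {f : Series}
    (h : IsPsumExpansion c f) (h' : IsPsumExpansion c' f) : c = c' := by
  classical
  by_contra hne
  have hex : ∃ k n, ∃ lam : Ptn, lam.1 = n ∧ lam.1 - lam.length = k ∧ c lam ≠ c' lam := by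
    obtain ⟨lam, hlam⟩ := Function.ne_iff.1 hne
    exact ⟨_, _, lam, rfl, rfl, hlam⟩
  obtain ⟨n, lam, hn, hk, hc⟩ := Nat.find_spec hex
  have hmin : ∀ nu : Ptn, c nu ≠ c' nu → lam.1 - lam.length ≤ nu.1 - nu.length := by
    intro nu hnu
    rw [hk]
    exact Nat.find_min' hex ⟨_, nu, rfl, rfl, hnu⟩
  set m : ℕ →₀ ℕ := ∑ i : Fin lam.length, Finsupp.single (i : ℕ) (lam.row i) with hm
  have hm0 : MvPowerSeries.coeff m (psumPtn lam) ≠ 0 :=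
    (coeff_psumPtn_ne_zero_iff lam m).2 ⟨fun i => i, rfl⟩
  have hvals := values_eq_parts lam (fun i => (i : ℕ)) Fin.val_injective m hm
  have key : ∀ nu : Ptn, c nu ≠ c' nu → MvPowerSeries.coeff m (psumPtn nu) ≠ 0 → nu = lam := by
    intro nu hnu hcoef
    obtain ⟨g, hg⟩ := (coeff_psumPtn_ne_zero_iff nu m).1 hcoef
    have hdeg : nu.1 = lam.1 := by
      rw [← nu.sum_row, ← lam.sum_row]
      have := congrArg Finsupp.degree (hm.symm.trans hg)
      simpa [map_sum] using this.symm
    have hcard : m.support.card = lam.length := by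
      have := congrArg Multiset.card hvals
      rw [Multiset.card_map] at this
      rw [Finset.card_def, this]
      simp [Ptn.length, Ptn.rows]
    have hsub : m.support ⊆ Finset.univ.image g := by
      intro x hx
      by_contra hcon
      apply Finsupp.mem_support_iff.1 hx
      rw [hg, Finsupp.finsetSum_apply]
      refine Finset.sum_eq_zero fun j _ => Finsupp.single_eq_of_ne fun h => hcon ?_
      exact Finset.mem_image.2 ⟨j, by simp, h.symm⟩
    have h1 := Finset.card_le_card hsub
    have h2 : (Finset.univ.image g).card ≤ nu.length := by
      simpa using Finset.card_image_le (s := Finset.univ) (f := g)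
    have h3 := hmin nu hnu
    have h4 := nu.length_le
    have h5 := lam.length_le
    have hinj : Function.Injective g := by
      rw [← Set.injOn_univ, ← Finset.coe_univ]
      apply Finset.injOn_of_card_image_eq
      simp only [Finset.card_univ, Fintype.card_fin]
      omega
    have hv := values_eq_parts nu g hinj m hg
    rw [hvals] at hv
    exact (Ptn.ext_parts hv).symm
  have hsum : ∑ᶠ nu, MvPowerSeries.coeff m (c nu • psumPtn nu) -
      ∑ᶠ nu, MvPowerSeries.coeff m (c' nu • psumPtn nu) = 0 := by
    have e := congrFun (h.2.symm.trans h'.2) m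
    exact sub_eq_zero.2 e
  rw [← finsum_sub_distrib (h.1 m) (h'.1 m), finsum_eq_single _ lam] at hsum
  · simp only [map_smul, smul_eq_mul, ← sub_mul] at hsum
    exact (mul_ne_zero (sub_ne_zero.2 hc) hm0) hsum
  · intro nu hnu
    by_cases hcn : c nu = c' nu
    · simp [hcn]
    · have : MvPowerSeries.coeff m (psumPtn nu) = 0 := by
        by_contra hcon
        exact hnu (key nu hcn hcon)
      simp [this]
open Classical in
/-- The involution `ω`, extended to symmetric power series of unbounded degree: if
`f = ∑_λ c_λ p_λ` then `ω f = ∑_λ (-1) ^ (|λ| - ℓ(λ)) c_λ p_λ`. The coefficients `c_λ` are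
unique, see `isPsumExpansion_unique`. -/
def omega (f : Series) : Series :=
  if h : ∃ c, IsPsumExpansion c f then
    formalSum fun lam : Ptn => ((-1) ^ (lam.1 - lam.length) * h.choose lam) • psumPtn lam
  else 0

/-! ### The `K`-theoretic power sums `p̄'` -/

open Classical in
/-- `p̄'_k`, defined by `1 + p̄'_k = ∏ᵢ (1 + xᵢ ^ k + xᵢ ^ (2k) + ⋯)` (for `k ≥ 1`): the sum of all
nonconstant monomials all of whose exponents are multiples of `k`;
see `one_add_pbar_mul_prod`. -/
def pbar (k : ℕ) : Series := fun m => if m ≠ 0 ∧ ∀ i, k ∣ m i then 1 else 0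

open Classical in
theorem coeff_pbar (k : ℕ) (m : ℕ →₀ ℕ) :
    MvPowerSeries.coeff m (pbar k) = if m ≠ 0 ∧ ∀ i, k ∣ m i then 1 else 0 := rfl

/-- The series `1 + p̄'_k` is the infinite product of the `1 / (1 - xᵢ ^ k)`: multiplied by
`∏_{i ∈ s} (1 - xᵢ ^ k)` it agrees with `1` on all monomials in the variables from `s`. -/
theorem one_add_pbar_mul_prod (k : ℕ) (hk : 0 < k) (s : Finset ℕ) (m : ℕ →₀ ℕ)
    (hm : m.support ⊆ s) :
    MvPowerSeries.coeff m ((1 + pbar k) * ∏ i ∈ s, (1 - MvPowerSeries.X i ^ k)) =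
      if m = 0 then 1 else 0 := by
  classical
  obtain ⟨A, hA0⟩ : ∃ A : Finset ℕ → Series, ∀ s m, MvPowerSeries.coeff m (A s) =
      if (∀ i ∈ s, m i = 0) ∧ ∀ i, k ∣ m i then 1 else 0 :=
    ⟨fun s m => if (∀ i ∈ s, m i = 0) ∧ ∀ i, k ∣ m i then 1 else 0, fun _ _ => rfl⟩
  have key : ∀ s : Finset ℕ, (1 + pbar k) * ∏ i ∈ s, (1 - MvPowerSeries.X i ^ k) = A s := by
    intro s
    induction s using Finset.induction_on with
    | empty =>
      ext1 m
      rw [Finset.prod_empty, mul_one, map_add, MvPowerSeries.coeff_one, coeff_pbar, hA0]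
      by_cases h : m = 0 <;> simp [h]
    | insert a s ha ih =>
      rw [Finset.prod_insert ha, mul_left_comm, ih, mul_comm, mul_sub, mul_one]
      ext1 m
      rw [map_sub, MvPowerSeries.X_pow_eq, MvPowerSeries.coeff_mul_monomial, mul_one, hA0, hA0, hA0]
      simp only [Finsupp.single_le_iff]
      by_cases hle : k ≤ m a
      · have hA : (∀ i ∈ s, (m - Finsupp.single a k) i = 0) ↔ ∀ i ∈ s, m i = 0 := by
          refine forall₂_congr fun i hi => ?_
          have hia : i ≠ a := fun h => ha (h ▸ hi)
          simp [Finsupp.single_eq_of_ne hia]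
        have hB : (∀ i, k ∣ (m - Finsupp.single a k) i) ↔ ∀ i, k ∣ m i := by
          refine forall_congr' fun i => ?_
          by_cases hia : i = a
          · subst hia
            simp only [Finsupp.coe_tsub, Pi.sub_apply, Finsupp.single_eq_same]
            exact Nat.dvd_sub_iff_left hle dvd_rfl
          · simp [Finsupp.single_eq_of_ne hia]
        have hC : ¬ ∀ i ∈ insert a s, m i = 0 := fun h => by
          have := h a (Finset.mem_insert_self a s)
          omega
        simp only [hA, hB, hC, if_pos hle, false_and, if_false, sub_self]
      · have hD : (∀ i, k ∣ m i) → m a = 0 := fun h =>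
          Nat.eq_zero_of_dvd_of_lt (h a) (by omega)
        rw [if_neg hle, sub_zero]
        congr 1
        simp only [Finset.forall_mem_insert]
        exact propext ⟨fun h => ⟨⟨hD h.2, h.1⟩, h.2⟩, fun h => ⟨h.1.2, h.2⟩⟩
  rw [key, hA0]
  congr 1
  refine propext ⟨fun h => ?_, fun h => by simp [h]⟩
  ext i
  by_cases hi : i ∈ s
  · exact h.1 i hi
  · exact Finsupp.notMem_support_iff.1 fun hh => hi (hm hh)

/-- `p̄'_λ = ∏ᵢ p̄'_{λᵢ}`. -/
def pbarPtn (lam : Ptn) : Series := ∏ i, pbar (lam.row i)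

/-- `ln (1 + f)` for a power series `f` without constant term. -/
def logOneAdd (f : Series) : Series := (PowerSeries.log (Polynomial ℚ)).subst f

/-- The series `∑_{d ≥ 1} (μ(d) / d) ln (1 + p̄'_{dk})`. -/
def moebiusLog (k : ℕ) : Series :=
  formalSum fun d : ℕ+ =>
    Polynomial.C ((ArithmeticFunction.moebius (d : ℕ) : ℚ) / (d : ℚ)) •
      logOneAdd (pbar (d * k))

/-- The family summed in `moebiusLog` is formally summable. -/
theorem formalSummable_moebiusLog (k : ℕ) (hk : 0 < k) :
    FormalSummable fun d : ℕ+ =>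
      Polynomial.C ((ArithmeticFunction.moebius (d : ℕ) : ℚ) / (d : ℚ)) •
        logOneAdd (pbar (d * k)) := by
  intro m
  have hsub : {d : ℕ+ | MvPowerSeries.coeff m
      (Polynomial.C ((ArithmeticFunction.moebius (d : ℕ) : ℚ) / (d : ℚ)) •
        logOneAdd (pbar (d * k))) ≠ 0} ⊆ {d : ℕ+ | (d : ℕ) ≤ m.degree} := by
    intro d hd
    by_contra hlt
    simp only [Set.mem_ofPred_eq, not_le] at hlt
    apply hd
    have hord : ((d : ℕ) : ℕ∞) ≤ (pbar (d * k)).order := by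
      refine MvPowerSeries.le_order fun n hn => ?_
      rw [coeff_pbar, if_neg]
      rintro ⟨hn0, hdvd⟩
      obtain ⟨i, hi⟩ := Finsupp.ne_iff.1 hn0
      have h1 : (d : ℕ) ≤ n i :=
        (Nat.le_mul_of_pos_right _ hk).trans (Nat.le_of_dvd (Nat.pos_of_ne_zero hi) (hdvd i))
      have h2 : n i ≤ n.degree := Finsupp.le_degree i n
      have h3 : n.degree < d := by exact_mod_cast hn
      omega
    have hsubst : PowerSeries.HasSubst (pbar (d * k)) := by
      apply PowerSeries.HasSubst.of_constantCoeff_zero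
      rw [← MvPowerSeries.coeff_zero_eq_constantCoeff_apply, coeff_pbar]
      simp
    rw [map_smul, logOneAdd, PowerSeries.coeff_subst hsubst]
    rw [finsum_eq_zero_of_forall_eq_zero, smul_zero]
    intro j
    rcases Nat.eq_zero_or_pos j with rfl | hj
    · simp
    · rw [MvPowerSeries.coeff_of_lt_order, smul_zero]
      refine lt_of_lt_of_le ?_ (MvPowerSeries.le_order_pow j)
      refine lt_of_lt_of_le ?_ (le_self_nsmul (zero_le) hj.ne')
      exact lt_of_lt_of_le (by exact_mod_cast hlt) hord
  refine Set.Finite.subset ?_ hsub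
  exact (Set.finite_Iic m.degree).preimage PNat.coe_injective.injOn

/-! ### The Kromatic quasisymmetric function -/

section Kromatic

variable {V : Type*}

/-- A proper set coloring: every vertex gets a nonempty (finite) set of colors, and adjacent
vertices get disjoint sets. -/
def IsProperSetColoring (G : SimpleGraph V) (κ : V → Finset ℕ) : Prop :=
  (∀ v, (κ v).Nonempty) ∧ ∀ u v, G.Adj u v → Disjoint (κ u) (κ v)

variable [Fintype V]

/-- The exponent vector of the monomial `∏_v ∏_{i ∈ κ v} xᵢ`. -/
def colorContent (κ : V → Finset ℕ) : ℕ →₀ ℕ := ∑ v, ∑ i ∈ κ v, Finsupp.single i 1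

/-- Every monomial comes from finitely many proper set colorings. -/
theorem finite_colorings (G : SimpleGraph V) (m : ℕ →₀ ℕ) :
    {κ : V → Finset ℕ | IsProperSetColoring G κ ∧ colorContent κ = m}.Finite := by
  classical
  refine (Set.Finite.pi' fun _ : V => m.support.powerset.finite_toSet).subset ?_
  rintro κ ⟨_, rfl⟩ v
  simp only [Finset.coe_powerset, Set.mem_preimage, Set.mem_powerset_iff, Finset.coe_subset]
  intro i hi
  have h1 : (∑ j ∈ κ v, Finsupp.single j 1 : ℕ →₀ ℕ) ≤ colorContent κ :=
    Finset.single_le_sum (f := fun v => (∑ j ∈ κ v, Finsupp.single j 1 : ℕ →₀ ℕ))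
      (fun _ _ => zero_le) (Finset.mem_univ v)
  have h2 : (Finsupp.single i 1 : ℕ →₀ ℕ) ≤ ∑ j ∈ κ v, Finsupp.single j 1 :=
    Finset.single_le_sum (f := fun j => (Finsupp.single j 1 : ℕ →₀ ℕ))
      (fun _ _ => zero_le) hi
  have h3 := Finsupp.single_le_iff.1 (h2.trans h1)
  exact Finsupp.mem_support_iff.2 (by omega)

variable [LinearOrder V]

open Classical in
/-- The number of quadruples `(u, v, i, j)` with `u, v` adjacent, `u < v`, `i ∈ κ u`, `j ∈ κ v`
and `i < j`. -/
def colorAsc (G : SimpleGraph V) (κ : V → Finset ℕ) : ℕ :=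
  ∑ e : V × V with G.Adj e.1 e.2 ∧ e.1 < e.2, ((κ e.1 ×ˢ κ e.2).filter fun p => p.1 < p.2).card

/-- The Kromatic quasisymmetric function
`X̄_G(q) = ∑_κ q ^ asc(κ) ∏_v ∏_{i ∈ κ v} xᵢ`, the sum over all proper set colorings. -/
def kromatic (G : SimpleGraph V) : Series := fun m =>
  ∑ᶠ κ ∈ {κ : V → Finset ℕ | IsProperSetColoring G κ ∧ colorContent κ = m},
    (Polynomial.X : Polynomial ℚ) ^ colorAsc G κ

end Kromatic

/-! ### Heaps and pyramids -/

section Heaps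

variable {V : Type*}

/-- Two consecutive letters of a word that are distinct nonadjacent vertices may be exchanged. -/
inductive CommStep (G : SimpleGraph V) : List V → List V → Prop
  | swap (a b : List V) (u v : V) (hne : u ≠ v) (hadj : ¬ G.Adj u v) :
      CommStep G (a ++ u :: v :: b) (a ++ v :: u :: b)

/-- Heaps on `G`: words in the vertices modulo the equivalence relation generated by exchanging
consecutive distinct nonadjacent letters. The letters of a word are the pieces of the heap,
and two pieces that come from equal or adjacent vertices are joined by an edge directed
from the earlier to the later one. -/
def Heap (G : SimpleGraph V) : Type _ := Quot (CommStep G)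

namespace Heap

variable {G : SimpleGraph V}

/-- The heap of a word. -/
def mk (w : List V) : Heap G := Quot.mk _ w

/-- Heaps under composition form the free partially commutative monoid on `G`. -/
instance : Monoid (Heap G) where
  one := mk []
  mul := Quot.map₂ (· ++ ·)
    (fun w _ _ h => by
      obtain ⟨a, b, u, v, hne, hadj⟩ := h
      simpa using CommStep.swap (G := G) (w ++ a) b u v hne hadj)
    (fun _ _ w h => by
      obtain ⟨a, b, u, v, hne, hadj⟩ := h
      simpa using CommStep.swap (G := G) a (b ++ w) u v hne hadj)
  mul_assoc := by
    rintro ⟨a⟩ ⟨b⟩ ⟨c⟩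
    exact congrArg (Quot.mk _) (List.append_assoc a b c)
  one_mul := by
    rintro ⟨a⟩
    rfl
  mul_one := by
    rintro ⟨a⟩
    exact congrArg (Quot.mk _) (List.append_nil a)

/-- The number of pieces. -/
def size : Heap G → ℕ := Quot.lift List.length (by rintro _ _ ⟨⟩; simp)

/-- The vertex `v` is used by the heap. -/
def Uses (v : V) : Heap G → Prop :=
  Quot.lift (v ∈ ·) (by rintro _ _ ⟨⟩; simp [or_left_comm])

/-- The piece at position `i` of the word `w` is a source: no earlier piece comes from the same
or an adjacent vertex. -/
def IsSource (G : SimpleGraph V) (w : List V) (i : Fin w.length) : Prop :=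
  ∀ j < i, w.get j ≠ w.get i ∧ ¬ G.Adj (w.get j) (w.get i)

/-- A pyramid is a heap with a unique source. -/
def IsPyramid (H : Heap G) : Prop :=
  ∃ w, mk w = H ∧ ∃! i, IsSource G w i

variable [LinearOrder V]

open Classical in
/-- The number of pairs of positions `i < j` of the word such that the letters `u` at `i` and `v`
at `j` are adjacent vertices with `u < v`. -/
def wordAsc (G : SimpleGraph V) : List V → ℕ
  | [] => 0
  | u :: w => w.countP (fun v => G.Adj u v ∧ u < v) + wordAsc G w

theorem wordAsc_swap (a b : List V) (u v : V) (h : ¬ G.Adj u v) :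
    wordAsc G (a ++ u :: v :: b) = wordAsc G (a ++ v :: u :: b) := by
  induction a with
  | nil =>
    have h' : ¬ G.Adj v u := fun hh => h hh.symm
    simp [wordAsc, h, h']
    omega
  | cons c a ih =>
    simp only [List.cons_append, wordAsc, ih, List.countP_append, List.countP_cons]
    omega

/-- The number of ascents of a heap: directed edges from a piece of a vertex `u` to a piece of a
vertex `v` with `u < v`; edges between copies of the same vertex do not count. -/
def asc : Heap G → ℕ :=
  Quot.lift (wordAsc G) (by rintro _ _ ⟨a, b, u, v, _, h⟩; exact wordAsc_swap a b u v h)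

end Heap

/-- Lists `(P₁, …, P_ℓ)` of pyramids with `|Pᵢ| = λᵢ` that together use all vertices of `G`. -/
def pyramidLists (G : SimpleGraph V) (lam : Ptn) : Set (List (Heap G)) :=
  {P | (∀ H ∈ P, H.IsPyramid) ∧ P.map Heap.size = lam.rows ∧ ∀ v, ∃ H ∈ P, H.Uses v}

/-- There are finitely many pyramid lists of each type. -/
theorem finite_pyramidLists [Finite V] (G : SimpleGraph V) (lam : Ptn) :
    (pyramidLists G lam).Finite := by
  have hsize : ∀ n, {H : Heap G | H.size = n}.Finite := by
    intro n
    refine ((List.finite_length_eq V n).image (Heap.mk (G := G))).subset ?_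
    rintro ⟨w⟩ hw
    exact ⟨w, hw, rfl⟩
  have hlist : ∀ l : List ℕ, {P : List (Heap G) | P.map Heap.size = l}.Finite := by
    intro l
    induction l with
    | nil => simp
    | cons n l ih =>
      refine ((hsize n).image2 List.cons ih).subset ?_
      rintro (_ | ⟨H, P⟩) hP
      · simp at hP
      · simp only [Set.mem_ofPred_eq, List.map_cons, List.cons.injEq] at hP
        exact ⟨H, hP.1, P, hP.2, rfl⟩
  exact (hlist lam.rows).subset fun P hP => hP.2.1

/-- `∑_P q ^ asc(P)` over the pyramid lists of type `λ` covering `V`, where `asc(P)` is the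
number of ascents of the heap `P₁ ∘ ⋯ ∘ P_ℓ`. -/
def pyramidSum [LinearOrder V] (G : SimpleGraph V) (lam : Ptn) : Polynomial ℚ :=
  ∑ᶠ P ∈ pyramidLists G lam, Polynomial.X ^ P.prod.asc

end Heaps

/-! ### The `p̄'`-coefficients -/

/-- A partition `λ'` with two sequences `d, n` of `ℓ(λ')` positive integers. -/
structure BlowUp where
  /-- the partition `λ'` -/
  ptn : Ptn
  /-- the multipliers `dᵢ` -/
  d : Fin ptn.length → ℕ+
  /-- the numbers of repetitions `nᵢ` -/
  n : Fin ptn.length → ℕ+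

/-- The parts of `(dλ')ⁿ`: the part `λ'ᵢ` is multiplied by `dᵢ` and repeated `nᵢ` times. -/
def BlowUp.parts (t : BlowUp) : Multiset ℕ :=
  ∑ i, Multiset.replicate (t.n i) (t.d i * t.ptn.row i)

/-- `∏ᵢ μ(dᵢ) (-1) ^ (nᵢ + 1) / (dᵢ nᵢ)`. -/
def BlowUp.weight (t : BlowUp) : ℚ :=
  ∏ i, (ArithmeticFunction.moebius (t.d i : ℕ) : ℚ) * (-1) ^ ((t.n i : ℕ) + 1) /
    ((t.d i : ℚ) * (t.n i : ℚ))

end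

end Kromatic

/-! The sums e_k of all stable sets of size k behave like elementary symmetric functions. A heap
acts on ℚ[q]-combinations of multisets of vertices (`Heap.op`): a letter adds itself, weighted by q
to the number of ascents it creates, so adjacent u < v satisfy uv = q·vu. Applied to the empty
multiset, a heap returns its content weighted by q^asc, and `coverSum` keeps the multisets that
contain every vertex. Since the color classes of a set coloring are stable sets stacked in the order
of the colors, the coefficient of x^m in X̄_G is `coverSum` of ∏ e_{m_i} (`coeff_kromatic`).

Two facts justify the analogy. The e_k commute (`stableSum_commute`); this rests on the interval
property of a natural labelling, that u < v < w with u, w adjacent forces v to be adjacent to both.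
Moreover, factoring stable sets off the left of heaps shows that the e_k are inverse, up to signs,
to the sums h_n of all heaps of size n, and that the sums p_n of the pyramids of size n are the
matching power sums: Newton's identities hold.

In the commutative algebra generated by the e_k the Cauchy identity ∑_m (∏ e_{m_i}) x^m = ∑_λ
(-1)^(|λ|-ℓ(λ)) z_λ⁻¹ p_λ p_λ(x) follows (`coeff_cycleSum_powerSum`). Its left side is symmetric,
`coverSum` turns p_λ into the pyramid sum, and ω removes the sign.

Finally ln(1 + p̄'_k) = ∑_n p_{nk}(x)/n, and Möbius inversion recovers p_k(x)
(`moebiusLog_eq_psum`). Expanding these logarithms gives the coefficients c_λ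
(`formalHasSum_pbarPtn`); they are unique because p̄'_λ begins with p_λ(x) in degree |λ|
(`pbarPtn_expansion_unique`). -/

namespace Kromatic

noncomputable section

/-! ### Sources of heaps and left division -/

namespace Heap

variable {V : Type*} {G : SimpleGraph V}

/-- The first occurrence of `v` in the word has no earlier adjacent letter. -/
def WordSource (G : SimpleGraph V) (v : V) : List V → Prop
  | [] => False
  | u :: w => u = v ∨ (¬ G.Adj u v ∧ WordSource G v w)

theorem wordSource_swap (a b : List V) (u x v : V) (h : ¬ G.Adj u x) :
    WordSource G v (a ++ u :: x :: b) ↔ WordSource G v (a ++ x :: u :: b) := by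
  induction a with
  | nil =>
    have h' : ¬ G.Adj x u := fun hh => h hh.symm
    simp only [List.nil_append, WordSource]
    by_cases hu : u = v
    · subst hu; simp [h']
    · by_cases hx : x = v
      · subst hx; simp [h]
      · simp only [hu, hx, false_or]; tauto
  | cons c a ih => simp only [List.cons_append, WordSource, ih]

/-- The vertex `v` labels a source of the heap. -/
def HasSource (v : V) : Heap G → Prop :=
  Quot.lift (WordSource G v)
    (by rintro _ _ ⟨a, b, u, x, _, h⟩; exact propext (wordSource_swap a b u x v h))

theorem mk_cons (v : V) (w : List V) : (mk (v :: w) : Heap G) = mk [v] * mk w := rfl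

theorem mk_nil : (mk [] : Heap G) = 1 := rfl

theorem not_hasSource_one (v : V) : ¬ HasSource v (1 : Heap G) := id

theorem hasSource_cons_mul (v u : V) (H : Heap G) :
    HasSource v (mk [u] * H) ↔ u = v ∨ (¬ G.Adj u v ∧ HasSource v H) := by
  obtain ⟨w⟩ := H
  exact Iff.rfl

theorem size_mul (H K : Heap G) : (H * K).size = H.size + K.size := by
  obtain ⟨w⟩ := H
  obtain ⟨w'⟩ := K
  exact List.length_append

theorem size_mk (w : List V) : (mk w : Heap G).size = w.length := rfl

theorem size_eq_zero {H : Heap G} : H.size = 0 ↔ H = 1 := by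
  constructor
  · obtain ⟨w⟩ := H
    intro h
    have hw : w = [] := List.length_eq_zero_iff.1 h
    subst hw
    rfl
  · rintro rfl; rfl

theorem wordSource_iff_exists (v : V) (w : List V) :
    WordSource G v w ↔ ∃ i, IsSource G w i ∧ w.get i = v := by
  induction w with
  | nil => exact ⟨False.elim, fun ⟨i, _⟩ => i.elim0⟩
  | cons u w ih =>
    simp only [WordSource, ih]
    constructor
    · rintro (rfl | ⟨hadj, i, hi, rfl⟩)
      · exact ⟨0, fun j hj => absurd hj (Fin.not_lt_zero j), rfl⟩
      · by_cases huv : u = w.get i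
        · exact ⟨0, fun j hj => absurd hj (Fin.not_lt_zero j), huv⟩
        · refine ⟨i.succ, fun j => ?_, rfl⟩
          refine Fin.cases ?_ (fun j => ?_) j
          · exact fun _ => ⟨huv, hadj⟩
          · exact fun hj => hi j (Fin.succ_lt_succ_iff.1 hj)
    · rintro ⟨i, hi, hv⟩
      revert hi hv
      refine Fin.cases ?_ (fun i => ?_) i
      · exact fun _ h => Or.inl h
      · rintro hi rfl
        refine Or.inr ⟨(hi 0 (Fin.succ_pos i)).2, i, fun j hj => ?_, rfl⟩
        exact hi j.succ (Fin.succ_lt_succ_iff.2 hj)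

/-- Two source positions with the same letter coincide, since the earlier one blocks the later.
Counting positions thus becomes counting vertices, which is invariant under exchanges by
`wordSource_swap`. -/
theorem existsUnique_isSource_iff (w : List V) :
    (∃! i, IsSource G w i) ↔ ∃! v, WordSource G v w := by
  have hinj : ∀ i j, IsSource G w i → IsSource G w j → w.get i = w.get j → i = j := by
    intro i j hi hj h
    rcases lt_trichotomy i j with hlt | rfl | hlt
    · exact absurd h (hj i hlt).1
    · rfl
    · exact absurd h.symm (hi j hlt).1
  simp only [wordSource_iff_exists]
  constructor
  · rintro ⟨i, hi, huniq⟩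
    refine ⟨w.get i, ⟨i, hi, rfl⟩, ?_⟩
    rintro _ ⟨j, hj, rfl⟩
    rw [huniq j hj]
  · rintro ⟨v, ⟨i, hi, rfl⟩, huniq⟩
    exact ⟨i, hi, fun j hj => hinj j i hj hi (huniq _ ⟨j, hj, rfl⟩)⟩

theorem isPyramid_iff (H : Heap G) : H.IsPyramid ↔ ∃! v, HasSource v H := by
  constructor
  · rintro ⟨w, rfl, h⟩
    exact (existsUnique_isSource_iff w).1 h
  · obtain ⟨w⟩ := H
    exact fun h => ⟨w, rfl, (existsUnique_isSource_iff w).2 h⟩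

theorem exists_hasSource {H : Heap G} (h : H ≠ 1) : ∃ v, HasSource v H := by
  obtain ⟨_ | ⟨u, w⟩⟩ := H
  · exact absurd rfl h
  · exact ⟨u, Or.inl rfl⟩

theorem not_adj_of_hasSource {u v : V} {H : Heap G} (hu : HasSource u H) (hv : HasSource v H) :
    ¬ G.Adj u v := by
  obtain ⟨w⟩ := H
  change WordSource G u w at hu
  change WordSource G v w at hv
  induction w with
  | nil => exact hu.elim
  | cons c w ih =>
    rcases hu with rfl | ⟨hcu, hu⟩ <;> rcases hv with rfl | ⟨hcv, hv⟩
    · exact G.irrefl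
    · exact hcv
    · exact fun h => hcu h.symm
    · exact ih hu hv

variable [DecidableEq V]

theorem mk_erase_swap (a b : List V) (u x v : V) (hne : u ≠ x) (h : ¬ G.Adj u x) :
    (mk ((a ++ u :: x :: b).erase v) : Heap G) = mk ((a ++ x :: u :: b).erase v) := by
  induction a with
  | nil =>
    simp only [List.nil_append, List.erase_cons, beq_iff_eq]
    by_cases hu : u = v
    · subst hu; simp [hne.symm]
    · by_cases hx : x = v
      · subst hx; simp [hu]
      · simp only [hu, hx, if_false]
        exact Quot.sound (CommStep.swap [] _ u x hne h)
  | cons c a ih =>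
    simp only [List.cons_append, List.erase_cons, beq_iff_eq]
    by_cases hc : c = v
    · simp only [hc, if_true]
      exact Quot.sound (CommStep.swap a b u x hne h)
    · simp only [hc, if_false]
      rw [mk_cons, ih, ← mk_cons]

/-- Removal of the first piece of the vertex `v`. -/
def erase (v : V) : Heap G → Heap G :=
  Quot.lift (fun w => mk (w.erase v))
    (by rintro _ _ ⟨a, b, u, x, hne, h⟩; exact mk_erase_swap a b u x v hne h)

theorem erase_mul (v : V) (H : Heap G) : erase v (mk [v] * H) = H := by
  obtain ⟨w⟩ := H
  exact congrArg (mk (G := G)) (List.erase_cons_head v w)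

/-- No letter before the first v is equal or adjacent to v, so exchanges carry it to the front. -/
theorem mul_erase {v : V} {H : Heap G} (h : HasSource v H) : mk [v] * erase v H = H := by
  obtain ⟨w⟩ := H
  change WordSource G v w at h
  change mk [v] * mk (w.erase v) = mk w
  induction w with
  | nil => exact h.elim
  | cons u w ih =>
    by_cases huv : u = v
    · subst huv; rw [List.erase_cons_head]; rfl
    · obtain ⟨hadj, h⟩ := h.resolve_left huv
      rw [List.erase_cons_tail (by simpa using huv), mk_cons u w, ← ih h, ← mk_cons, ← mk_cons,
        ← mk_cons]
      exact Quot.sound (CommStep.swap [] _ v u (Ne.symm huv) fun hh => hadj hh.symm)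

/-- A word of distinct pairwise nonadjacent letters is a left divisor exactly of those heaps which
have all its letters as sources. -/
theorem exists_mul_eq_iff {w : List V} (hw : w.Pairwise fun u v => u ≠ v ∧ ¬ G.Adj u v)
    (H : Heap G) : (∃ K, mk w * K = H) ↔ ∀ v ∈ w, HasSource v H := by
  induction w generalizing H with
  | nil => simpa using ⟨H, one_mul H⟩
  | cons u w ih =>
    obtain ⟨hu, hw⟩ := List.pairwise_cons.1 hw
    have hsrc : ∀ K : Heap G, (∀ v ∈ w, HasSource v (mk [u] * K)) ↔ ∀ v ∈ w, HasSource v K := by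
      intro K
      refine forall₂_congr fun v hv => ?_
      rw [hasSource_cons_mul]
      have := hu v hv
      tauto
    constructor
    · rintro ⟨K, rfl⟩
      rw [mk_cons, mul_assoc, List.forall_mem_cons, hsrc, ← ih hw]
      exact ⟨(hasSource_cons_mul _ _ _).2 (Or.inl rfl), K, rfl⟩
    · intro h
      rw [List.forall_mem_cons] at h
      obtain ⟨hsu, h⟩ := h
      rw [← mul_erase hsu, hsrc, ← ih hw] at h
      obtain ⟨K, hK⟩ := h
      exact ⟨K, by rw [mk_cons, mul_assoc, hK, mul_erase hsu]⟩

/-- `erase` undoes left multiplication by a letter, so a word is cancelled letter by letter. -/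
theorem mk_mul_left_injective (w : List V) : Function.Injective fun K : Heap G => mk w * K := by
  induction w with
  | nil => exact fun K K' h => by simpa [mk_nil] using h
  | cons u w ih =>
    intro K K' h
    apply ih
    have h' := congrArg (erase u) h
    simpa only [mk_cons u w, mul_assoc, erase_mul] using h'

end Heap

end

end Kromatic

namespace Kromatic

noncomputable section

/-! ### Stable sets, heaps of given size and source sets -/

section Sets

variable {V : Type*}

open Classical in
/-- The stable subsets of a set of vertices. -/
def stableSets (G : SimpleGraph V) (s : Finset V) : Finset (Finset V) :=
  s.powerset.filter fun S => ∀ u ∈ S, ∀ v ∈ S, ¬ G.Adj u v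

theorem mem_stableSets {G : SimpleGraph V} {s S : Finset V} :
    S ∈ stableSets G s ↔ S ⊆ s ∧ ∀ u ∈ S, ∀ v ∈ S, ¬ G.Adj u v := by
  simp [stableSets]

variable [Fintype V]

theorem finite_heaps_size (G : SimpleGraph V) (n : ℕ) : {H : Heap G | H.size = n}.Finite := by
  refine ((List.finite_length_eq V n).image (Heap.mk (G := G))).subset ?_
  rintro ⟨w⟩ hw
  exact ⟨w, hw, rfl⟩

/-- The heaps of size `n`. -/
def heapsOfSize (G : SimpleGraph V) (n : ℕ) : Finset (Heap G) := (finite_heaps_size G n).toFinset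

theorem mem_heapsOfSize {G : SimpleGraph V} {n : ℕ} {H : Heap G} :
    H ∈ heapsOfSize G n ↔ H.size = n := by
  simp [heapsOfSize]

open Classical in
/-- The vertices that label the sources of a heap. -/
def sourceSet {G : SimpleGraph V} (H : Heap G) : Finset V := Finset.univ.filter H.HasSource

theorem mem_sourceSet {G : SimpleGraph V} {H : Heap G} {v : V} :
    v ∈ sourceSet H ↔ H.HasSource v := by
  simp [sourceSet]

end Sets

variable {V : Type*} [LinearOrder V]

/-! ### The quantum torus representation of heaps -/

open Classical in
/-- The number of ascents created by putting the letter `v` before the letters of `β`. -/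
def crossing (G : SimpleGraph V) (v : V) (β : Multiset V) : ℕ :=
  β.countP fun u => G.Adj v u ∧ v < u

theorem crossing_cons_of_not_adj {G : SimpleGraph V} {v u : V} (h : ¬ G.Adj v u)
    (β : Multiset V) : crossing G v (u ::ₘ β) = crossing G v β := by
  simp [crossing, h]

theorem crossing_cons_of_lt {G : SimpleGraph V} {v u : V} (h : G.Adj v u) (hlt : v < u)
    (β : Multiset V) : crossing G v (u ::ₘ β) = crossing G v β + 1 := by
  simp [crossing, h, hlt]

theorem crossing_cons_of_gt {G : SimpleGraph V} {v u : V} (hlt : u < v)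
    (β : Multiset V) : crossing G v (u ::ₘ β) = crossing G v β := by
  simp [crossing, hlt.le]

/-- The endomorphisms of the free `ℚ[q]`-module on the finite multisets of vertices. -/
def TorusEnd (V : Type*) : Type _ :=
  Module.End (Polynomial ℚ) (Multiset V →₀ Polynomial ℚ)

namespace TorusEnd

variable {V : Type*}

instance : Ring (TorusEnd V) :=
  inferInstanceAs (Ring (Module.End (Polynomial ℚ) (Multiset V →₀ Polynomial ℚ)))

instance : Algebra (Polynomial ℚ) (TorusEnd V) :=
  inferInstanceAs (Algebra (Polynomial ℚ)
    (Module.End (Polynomial ℚ) (Multiset V →₀ Polynomial ℚ)))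

instance : Algebra ℚ (TorusEnd V) :=
  inferInstanceAs (Algebra ℚ (Module.End (Polynomial ℚ) (Multiset V →₀ Polynomial ℚ)))

/-- The value of an endomorphism at a multiset. -/
def apply (f : TorusEnd V) (β : Multiset V) : Multiset V →₀ Polynomial ℚ :=
  (show Module.End (Polynomial ℚ) (Multiset V →₀ Polynomial ℚ) from f) (Finsupp.single β 1)

theorem ext {f g : TorusEnd V} (h : ∀ β, f.apply β = g.apply β) : f = g :=
  Finsupp.lhom_ext' fun β => LinearMap.ext_ring (h β)

/-- The entries of the matrix of an endomorphism. -/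
def entry (α β : Multiset V) : TorusEnd V →ₗ[Polynomial ℚ] Polynomial ℚ where
  toFun f := f.apply β α
  map_add' _ _ := rfl
  map_smul' _ _ := rfl

theorem ext_entry {f g : TorusEnd V} (h : ∀ α β, entry α β f = entry α β g) : f = g :=
  ext fun β => Finsupp.ext fun α => h α β

/-- Letters send basis vectors to multiples of basis vectors, so a product is evaluated by following
a single one. -/
theorem mul_apply_of_apply_eq_single {f g : TorusEnd V} {α β : Multiset V} {c : Polynomial ℚ}
    (h : g.apply β = Finsupp.single α c) : (f * g).apply β = c • f.apply α := by
  change (show Module.End (Polynomial ℚ) (Multiset V →₀ Polynomial ℚ) from f) (g.apply β) = _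
  rw [h, ← Finsupp.smul_single_one, map_smul]
  rfl

end TorusEnd

/-- The vertex `v` acts by adding itself to a multiset, weighted by the number of new ascents. -/
def letterOp (G : SimpleGraph V) (v : V) : TorusEnd V :=
  (Finsupp.linearCombination (Polynomial ℚ) fun β =>
    Finsupp.single (v ::ₘ β) (Polynomial.X ^ crossing G v β) :
      Module.End (Polynomial ℚ) (Multiset V →₀ Polynomial ℚ))

theorem letterOp_apply (G : SimpleGraph V) (v : V) (β : Multiset V) :
    (letterOp G v).apply β = Finsupp.single (v ::ₘ β) (Polynomial.X ^ crossing G v β) := by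
  refine (Finsupp.linearCombination_single (Polynomial ℚ) 1 β).trans ?_
  rw [one_smul]

theorem letterOp_mul_apply (G : SimpleGraph V) (u v : V) (β : Multiset V) :
    (letterOp G u * letterOp G v).apply β = Finsupp.single (u ::ₘ v ::ₘ β)
      (Polynomial.X ^ crossing G v β * Polynomial.X ^ crossing G u (v ::ₘ β)) := by
  rw [TorusEnd.mul_apply_of_apply_eq_single (letterOp_apply G v β), letterOp_apply,
    Finsupp.smul_single, smul_eq_mul]

theorem letterOp_comm {G : SimpleGraph V} {u v : V} (h : ¬ G.Adj u v) :
    letterOp G u * letterOp G v = letterOp G v * letterOp G u := by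
  refine TorusEnd.ext fun β => ?_
  rw [letterOp_mul_apply, letterOp_mul_apply, crossing_cons_of_not_adj h,
    crossing_cons_of_not_adj fun hh => h (G.adj_symm hh), Multiset.cons_swap, mul_comm]

theorem letterOp_mul_of_lt {G : SimpleGraph V} {u v : V} (h : G.Adj u v) (hlt : u < v) :
    letterOp G u * letterOp G v =
      (Polynomial.X : Polynomial ℚ) • (letterOp G v * letterOp G u) := by
  refine TorusEnd.ext fun β => ?_
  change _ = (Polynomial.X : Polynomial ℚ) • (letterOp G v * letterOp G u).apply β
  rw [letterOp_mul_apply, letterOp_mul_apply, crossing_cons_of_lt h hlt, crossing_cons_of_gt hlt,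
    Finsupp.smul_single, Multiset.cons_swap, smul_eq_mul]
  congr 1
  ring

namespace Heap

variable {G : SimpleGraph V}

/-- The representation of the monoid of heaps. -/
def op : Heap G →* TorusEnd V where
  toFun := Quot.lift (fun w => (w.map (letterOp G)).prod) (by
    rintro _ _ ⟨a, b, u, v, _, h⟩
    simp only [List.map_append, List.map_cons, List.prod_append, List.prod_cons]
    rw [← mul_assoc (letterOp G u), letterOp_comm h, mul_assoc])
  map_one' := rfl
  map_mul' := by
    rintro ⟨a⟩ ⟨b⟩
    change ((a ++ b).map (letterOp G)).prod = (a.map (letterOp G)).prod * (b.map (letterOp G)).prod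
    rw [List.map_append, List.prod_append]

theorem op_mk (w : List V) : op (mk w : Heap G) = (w.map (letterOp G)).prod := rfl

/-- Letters act from the right end of the word, so each new one stands before those already in the
multiset, and `crossing` counts exactly what `wordAsc` adds. -/
theorem op_mk_apply (w : List V) : (op (mk w : Heap G)).apply 0 =
    Finsupp.single (w : Multiset V) (Polynomial.X ^ wordAsc G w) := by
  induction w with
  | nil => rfl
  | cons u w ih =>
    rw [mk_cons, map_mul, TorusEnd.mul_apply_of_apply_eq_single ih, op_mk, List.map_singleton,
      List.prod_singleton, letterOp_apply, Finsupp.smul_single, smul_eq_mul, wordAsc, ← pow_add,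
      add_comm]
    rfl

end Heap

open Classical in
/-- Applying an endomorphism to the empty multiset and adding up the coefficients of the
multisets that contain all elements of `V`. -/
def coverSum : TorusEnd V →ₗ[ℚ] Polynomial ℚ :=
  ((Finsupp.linearCombination (Polynomial ℚ) fun β : Multiset V =>
    if ∀ v, v ∈ β then (1 : Polynomial ℚ) else 0).restrictScalars ℚ) ∘ₗ
    { toFun := fun f => f.apply 0
      map_add' := fun _ _ => rfl
      map_smul' := fun _ _ => rfl }

theorem coverSum_op {G : SimpleGraph V} (H : Heap G) [Decidable (∀ v, H.Uses v)] :
    coverSum (Heap.op H) = if ∀ v, H.Uses v then Polynomial.X ^ H.asc else 0 := by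
  classical
  obtain ⟨w, rfl⟩ : ∃ w, Heap.mk w = H := Quot.exists_rep H
  change Finsupp.linearCombination _ _ ((Heap.op (Heap.mk w)).apply 0) = _
  rw [Heap.op_mk_apply, Finsupp.linearCombination_single, smul_ite, smul_zero, smul_eq_mul, mul_one]
  exact if_congr Iff.rfl rfl rfl

/-! ### Stable sets -/

/-- The heap of a stable set of vertices. -/
def setHeap (G : SimpleGraph V) (S : Finset V) : Heap G := Heap.mk (S.sort (· ≥ ·))

theorem size_setHeap (G : SimpleGraph V) (S : Finset V) : (setHeap G S).size = S.card := by
  rw [setHeap, Heap.size_mk, Finset.length_sort]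

theorem exists_setHeap_mul_iff {G : SimpleGraph V} {S : Finset V}
    (hS : ∀ u ∈ S, ∀ v ∈ S, ¬ G.Adj u v) (H : Heap G) :
    (∃ K, setHeap G S * K = H) ↔ ∀ v ∈ S, H.HasSource v := by
  rw [setHeap, Heap.exists_mul_eq_iff]
  · simp
  · have h1 := S.sort_nodup (· ≥ ·)
    refine (List.Pairwise.imp_of_mem ?_ h1)
    intro u v hu hv huv
    exact ⟨huv, hS u (by simpa using hu) v (by simpa using hv)⟩

variable [Fintype V]

/-- The sum of the stable sets of size `k`. -/
def stableSum (G : SimpleGraph V) (k : ℕ) : TorusEnd V :=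
  ∑ S ∈ stableSets G Finset.univ with S.card = k, Heap.op (setHeap G S)

theorem stableSum_zero (G : SimpleGraph V) : stableSum G 0 = 1 := by
  have : {S ∈ stableSets G Finset.univ | S.card = 0} = {∅} := by
    ext S
    simp only [Finset.mem_filter, mem_stableSets, Finset.card_eq_zero, Finset.mem_singleton]
    exact ⟨fun h => h.2, fun h => by subst h; simp⟩
  rw [stableSum, this, Finset.sum_singleton, setHeap, Finset.sort_empty]
  exact map_one Heap.op

/-- The sum of the heaps of size `n`. -/
def heapSum (G : SimpleGraph V) (n : ℕ) : TorusEnd V := ∑ H ∈ heapsOfSize G n, Heap.op H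

open Classical in
/-- The sum of the pyramids of size `n`. -/
def pyramidOp (G : SimpleGraph V) (n : ℕ) : TorusEnd V :=
  ∑ H ∈ heapsOfSize G n with H.IsPyramid, Heap.op H

-- Left multiplication by the heap of S is injective, and its image consists of the heaps having all
-- of S as sources.
open Classical in
theorem sum_op_setHeap_mul {G : SimpleGraph V} {S : Finset V} (hS : S ∈ stableSets G Finset.univ)
    {n k j : ℕ} (hk : S.card = k) (hn : k + j = n) :
    ∑ K ∈ heapsOfSize G j, Heap.op (setHeap G S) * Heap.op K =
      ∑ H ∈ heapsOfSize G n with S ⊆ sourceSet H, Heap.op H := by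
  have hstab := (mem_stableSets.1 hS).2
  refine Finset.sum_bij (fun K _ => setHeap G S * K) ?_ ?_ ?_ ?_
  · intro K hK
    rw [mem_heapsOfSize] at hK
    rw [Finset.mem_filter, mem_heapsOfSize, Heap.size_mul, size_setHeap, hK, hk, hn]
    refine ⟨rfl, fun v hv => ?_⟩
    rw [mem_sourceSet]
    exact (exists_setHeap_mul_iff hstab _).1 ⟨K, rfl⟩ v hv
  · intro K _ K' _ h
    exact Heap.mk_mul_left_injective _ h
  · intro H hH
    rw [Finset.mem_filter, mem_heapsOfSize] at hH
    obtain ⟨K, rfl⟩ := (exists_setHeap_mul_iff hstab H).2 fun v hv => mem_sourceSet.1 (hH.2 hv)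
    refine ⟨K, ?_, rfl⟩
    rw [Heap.size_mul, size_setHeap] at hH
    rw [mem_heapsOfSize]
    omega
  · intro K _
    rw [map_mul]

/-- Double counting of the factorisations H = S ∘ K with S stable: for fixed H they correspond to
the subsets of its source set, so a weight depending on |S| can be summed heap by heap. -/
theorem sum_stableSum_mul_heapSum (G : SimpleGraph V) (c : ℕ → ℤ) (n : ℕ) :
    ∑ p ∈ Finset.HasAntidiagonal.antidiagonal n, c p.1 • (stableSum G p.1 * heapSum G p.2) =
      ∑ H ∈ heapsOfSize G n, (∑ S ∈ (sourceSet H).powerset, c S.card) • Heap.op H := by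
  classical
  have h1 : ∀ p ∈ Finset.HasAntidiagonal.antidiagonal n, c p.1 • (stableSum G p.1 * heapSum G p.2) =
      ∑ S ∈ stableSets G Finset.univ with S.card = p.1,
        c S.card • ∑ H ∈ heapsOfSize G n with S ⊆ sourceSet H, Heap.op H := by
    intro p hp
    rw [Finset.HasAntidiagonal.mem_antidiagonal] at hp
    rw [stableSum, heapSum, Finset.sum_mul, Finset.smul_sum]
    refine Finset.sum_congr rfl fun S hS => ?_
    rw [Finset.mem_filter] at hS
    rw [Finset.mul_sum, sum_op_setHeap_mul hS.1 hS.2 hp, hS.2]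
  -- Larger stable sets divide no heap of size n, so the bound k ≤ n from the antidiagonal loses
  -- nothing.
  have hcard : ∀ (S : Finset V) (H : Heap G), H ∈ heapsOfSize G n →
      S ∈ stableSets G Finset.univ → S ⊆ sourceSet H → S.card ≤ n := by
    intro S H hH hS hSH
    obtain ⟨K, rfl⟩ := (exists_setHeap_mul_iff (mem_stableSets.1 hS).2 H).2
      fun v hv => mem_sourceSet.1 (hSH hv)
    rw [mem_heapsOfSize, Heap.size_mul, size_setHeap] at hH
    omega
  rw [Finset.sum_congr rfl h1, Finset.Nat.sum_antidiagonal_eq_sum_range_succ_mk]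
  simp only
  have h2 : ∑ k ∈ Finset.range n.succ, ∑ S ∈ stableSets G Finset.univ with S.card = k,
      c S.card • ∑ H ∈ heapsOfSize G n with S ⊆ sourceSet H, Heap.op H =
      ∑ S ∈ stableSets G Finset.univ,
        c S.card • ∑ H ∈ heapsOfSize G n with S ⊆ sourceSet H, Heap.op H := by
    rw [Finset.sum_fiberwise_eq_sum_filter, Finset.sum_filter]
    refine Finset.sum_congr rfl fun S hS => ?_
    rw [ite_eq_left_iff]
    intro hn
    rw [Finset.sum_eq_zero, smul_zero]
    intro H hH
    rw [Finset.mem_filter] at hH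
    exact absurd (Finset.mem_range.2 (Nat.lt_succ_of_le (hcard S H hH.1 hS hH.2))) hn
  rw [h2]
  simp only [Finset.sum_filter, Finset.smul_sum]
  rw [Finset.sum_comm]
  refine Finset.sum_congr rfl fun H _ => ?_
  rw [Finset.sum_smul]
  simp only [smul_ite, smul_zero]
  rw [← Finset.sum_filter]
  refine Finset.sum_congr ?_ fun _ _ => rfl
  -- Sources are pairwise nonadjacent, so every subset of a source set is automatically stable.
  ext S
  rw [Finset.mem_filter, mem_stableSets, Finset.mem_powerset]
  refine ⟨fun h => h.2, fun h => ⟨⟨Finset.subset_univ S, fun u hu v hv => ?_⟩, h⟩⟩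
  exact Heap.not_adj_of_hasSource (mem_sourceSet.1 (h hu)) (mem_sourceSet.1 (h hv))

/-- Cartier–Foata inversion: the alternating sum over subsets of the source set vanishes unless
there is no source, and only the empty heap has none. -/
theorem sum_stableSum_mul_heapSum_eq_ite (G : SimpleGraph V) (n : ℕ) :
    ∑ p ∈ Finset.HasAntidiagonal.antidiagonal n, (-1 : ℤ) ^ p.1 • (stableSum G p.1 * heapSum G p.2) =
      if n = 0 then 1 else 0 := by
  rw [sum_stableSum_mul_heapSum G (fun k => (-1) ^ k)]
  simp only [Finset.sum_powerset_neg_one_pow_card]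
  have hsrc : ∀ H : Heap G, sourceSet H = ∅ ↔ H = 1 := by
    intro H
    constructor
    · intro h
      by_contra hne
      obtain ⟨v, hv⟩ := Heap.exists_hasSource hne
      simpa [h] using mem_sourceSet.2 hv
    · rintro rfl
      exact Finset.eq_empty_of_forall_notMem fun v hv => Heap.not_hasSource_one v (mem_sourceSet.1 hv)
  simp only [ite_smul, one_smul, zero_smul]
  have hone : (1 : Heap G) ∈ heapsOfSize G n ↔ n = 0 := by
    rw [mem_heapsOfSize, Heap.size_eq_zero.2 rfl, eq_comm]
  split_ifs with hn
  · rw [Finset.sum_eq_single_of_mem 1 (hone.2 hn) 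
      fun H _ hH => if_neg fun h => hH ((hsrc H).1 h), if_pos ((hsrc 1).2 rfl), map_one]
  · exact Finset.sum_eq_zero fun H hH => if_neg fun h => hn (hone.1 ((hsrc H).1 h ▸ hH))

/-- Pairing S with S ∪ {a} cancels the weighted terms and leaves the plain alternating sum over the
subsets of A, which is nonzero only for A = ∅. -/
theorem sum_powerset_neg_one_pow_card_mul_card {α : Type*} [DecidableEq α] (A : Finset α) :
    ∑ S ∈ A.powerset, (-1 : ℤ) ^ (S.card + 1) * S.card = if A.card = 1 then 1 else 0 := by
  induction A using Finset.induction_on with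
  | empty => simp
  | insert a A ha ih =>
    rw [Finset.sum_powerset_insert ha]
    have h : ∀ S ∈ A.powerset, (-1 : ℤ) ^ ((insert a S).card + 1) * (insert a S).card =
        (-1) ^ S.card - (-1) ^ (S.card + 1) * S.card := by
      intro S hS
      rw [Finset.card_insert_of_notMem fun h => ha (Finset.mem_powerset.1 hS h)]
      push_cast
      ring
    rw [Finset.sum_congr rfl h, Finset.sum_sub_distrib, add_sub_cancel,
      Finset.sum_powerset_neg_one_pow_card, Finset.card_insert_of_notMem ha]
    simp [Finset.card_eq_zero]

/-- The extra weight k makes the sum over subsets detect source sets with exactly one element, that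
is, pyramids. -/
theorem sum_stableSum_mul_heapSum_eq_pyramidOp (G : SimpleGraph V) (n : ℕ) :
    ∑ p ∈ Finset.HasAntidiagonal.antidiagonal n,
      ((-1 : ℤ) ^ (p.1 + 1) * p.1) • (stableSum G p.1 * heapSum G p.2) = pyramidOp G n := by
  classical
  rw [sum_stableSum_mul_heapSum G (fun k => (-1) ^ (k + 1) * k), pyramidOp, Finset.sum_filter]
  refine Finset.sum_congr rfl fun H _ => ?_
  rw [sum_powerset_neg_one_pow_card_mul_card, ite_smul, one_smul, zero_smul]
  congr 1
  rw [Heap.isPyramid_iff, Finset.card_eq_one, Finset.singleton_iff_unique_mem]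
  simp only [mem_sourceSet]

end

end Kromatic

namespace Kromatic

noncomputable section

/-! ### Commutation of the generating functions of stable sets -/

section Algebra

variable {K T : Type*} [CommRing K] [Ring T] [Algebra K T] {y A A' B B' M M' : T} {x z q : K}

/-- The relation that allows one to add a last vertex; the letters `A, B` and `A', B'` stand for
generating functions in the variables `x` and `z`. -/
def ExchangeRel (x z q : K) (A A' B B' : T) : Prop :=
  z • ((1 - q) • (B * B') + q • (A * B') - B' * A) =
    x • ((1 - q) • (B' * B) + q • (A' * B) - B * A')

/-- Once y is moved to the left of A and A', this is y times `ExchangeRel`. The expression is the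
mixed part of the commutator in `commute_extend`. -/
theorem exchangeRel_mul (hAy : A * y = y * (B + q • (A - B)))
    (hAy' : A' * y = y * (B' + q • (A' - B'))) (hR : ExchangeRel x z q A A' B B') :
    z • (A * (y * B') - y * B' * A) + x • (y * B * A' - A' * (y * B)) = 0 := by
  have h := congrArg (y * ·) hR
  rw [← mul_assoc, ← mul_assoc, hAy, hAy']
  simp only [mul_add, mul_sub, mul_smul_comm, add_mul, sub_mul, smul_mul_assoc, mul_assoc] at h ⊢
  linear_combination (norm := module) h

/-- In the application A belongs to a vertex set, y to a new largest vertex, and B to the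
non-neighbours of y in that set. In the commutator the constant part vanishes by `hA`, the part with
xz because yB and yB' commute, and the mixed part by `exchangeRel_mul`. -/
theorem commute_extend (hAy : A * y = y * (B + q • (A - B)))
    (hAy' : A' * y = y * (B' + q • (A' - B'))) (hBy : B * y = y * B) (hBy' : B' * y = y * B')
    (hA : A * A' = A' * A) (hB : B * B' = B' * B) (hR : ExchangeRel x z q A A' B B') :
    (A + x • (y * B)) * (A' + z • (y * B')) = (A' + z • (y * B')) * (A + x • (y * B)) := by
  have h := exchangeRel_mul hAy hAy' hR
  have h2 : y * B * (y * B') = y * B' * (y * B) := by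
    rw [mul_assoc, ← mul_assoc B, hBy, mul_assoc y B, hB, mul_assoc y B', ← mul_assoc B', hBy',
      mul_assoc y B']
  simp only [mul_add, add_mul, smul_mul_assoc, mul_smul_comm]
  rw [hA, h2]
  linear_combination (norm := module) h

/-- Here only the larger set of the pair (A, M) gains the vertex y. The defect in the new terms is
xzq times y times the skew relation `hC` between M and B. -/
theorem exchangeRel_extend (hMy : M * y = y * (B + q • (M - B)))
    (hMy' : M' * y = y * (B' + q • (M' - B'))) (hB : B * B' = B' * B)
    (hC : B * M' - M' * B + (M * B' - B' * M) = 0) (hR : ExchangeRel x z q A A' M M') :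
    ExchangeRel x z q (A + x • (y * B)) (A' + z • (y * B')) M M' := by
  unfold ExchangeRel at hR ⊢
  have h := congrArg (y * ·) hC
  have h1 : M * (y * B') = y * ((B + q • (M - B)) * B') := by rw [← mul_assoc, hMy, mul_assoc]
  have h1' : M' * (y * B) = y * ((B' + q • (M' - B')) * B) := by rw [← mul_assoc, hMy', mul_assoc]
  simp only [mul_add, add_mul, smul_mul_assoc, mul_smul_comm, h1, h1']
  simp only [mul_add, mul_sub, mul_zero] at h
  simp only [mul_sub, sub_mul, mul_assoc, hB]
  linear_combination (norm := module) hR + (x * z * q) • h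

/-- Supplies the skew relation consumed by `exchangeRel_extend`: the new terms are those of
`exchangeRel_mul` for the pair (M, B). -/
theorem skewCommute_extend (hMy : M * y = y * (B + q • (M - B)))
    (hMy' : M' * y = y * (B' + q • (M' - B'))) (hC : M * A' - A' * M + (A * M' - M' * A) = 0)
    (hR : ExchangeRel x z q M M' B B') :
    M * (A' + z • (y * B')) - (A' + z • (y * B')) * M +
      ((A + x • (y * B)) * M' - M' * (A + x • (y * B))) = 0 := by
  have h := exchangeRel_mul hMy hMy' hR
  simp only [mul_add, add_mul, smul_mul_assoc, mul_smul_comm]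
  linear_combination (norm := module) h + hC

end Algebra

/-- A polynomial with coefficients in a free module that vanishes at all scalars is zero. -/
theorem eq_zero_of_sum_pow_smul_eq_zero {V : Type*} {n : ℕ} (f : ℕ → TorusEnd V)
    (h : ∀ x : Polynomial ℚ, ∑ k ∈ Finset.range n, x ^ k • f k = 0) :
    ∀ k < n, f k = 0 := by
  intro k hk
  refine TorusEnd.ext_entry fun α β => ?_
  have hp : ∑ k ∈ Finset.range n,
      Polynomial.C (TorusEnd.entry α β (f k)) * Polynomial.X ^ k = 0 := by
    refine Polynomial.funext fun x => ?_
    have := congrArg (TorusEnd.entry α β) (h x)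
    rw [map_sum, map_zero] at this
    rw [Polynomial.eval_finsetSum, Polynomial.eval_zero, ← this]
    refine Finset.sum_congr rfl fun k _ => ?_
    rw [map_smul, Polynomial.eval_mul, Polynomial.eval_C, Polynomial.eval_pow, Polynomial.eval_X,
      smul_eq_mul, mul_comm]
  have := congrArg (Polynomial.coeff · k) hp
  simpa [Polynomial.finsetSum_coeff, Polynomial.coeff_C_mul, Polynomial.coeff_X_pow, hk] using this

variable {V : Type*} [LinearOrder V] {G : SimpleGraph V}

/-- The generating function of the stable sets contained in `s`. -/
def stableGen (G : SimpleGraph V) (s : Finset V) (x : Polynomial ℚ) : TorusEnd V :=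
  ∑ S ∈ stableSets G s, x ^ S.card • Heap.op (setHeap G S)

open Classical in
theorem stableSets_insert {a : V} {s : Finset V} (ha : a ∉ s) :
    stableSets G (insert a s) =
      stableSets G s ∪ (stableSets G (s.filter fun b => ¬ G.Adj a b)).image (insert a) := by
  ext S
  simp only [Finset.mem_union, Finset.mem_image, mem_stableSets]
  constructor
  · rintro ⟨hS, hstab⟩
    by_cases haS : a ∈ S
    · refine Or.inr ⟨S.erase a, ⟨fun b hb => ?_, fun u hu v hv => ?_⟩, Finset.insert_erase haS⟩
      · rw [Finset.mem_erase] at hb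
        rw [Finset.mem_filter]
        exact ⟨(Finset.mem_insert.1 (hS hb.2)).resolve_left hb.1, hstab a haS b hb.2⟩
      · exact hstab u (Finset.mem_of_mem_erase hu) v (Finset.mem_of_mem_erase hv)
    · exact Or.inl ⟨(Finset.subset_insert_iff_of_notMem haS).1 hS, hstab⟩
  · rintro (⟨hS, hstab⟩ | ⟨S, ⟨hS, hstab⟩, rfl⟩)
    · exact ⟨hS.trans (Finset.subset_insert a s), hstab⟩
    · refine ⟨Finset.insert_subset_insert a (hS.trans (Finset.filter_subset _ _)), ?_⟩
      have h : ∀ b ∈ S, ¬ G.Adj a b := fun b hb => (Finset.mem_filter.1 (hS hb)).2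
      intro u hu v hv
      rw [Finset.mem_insert] at hu hv
      rcases hu with rfl | hu <;> rcases hv with rfl | hv
      · exact G.irrefl
      · exact h v hv
      · exact fun hh => h u hu hh.symm
      · exact hstab u hu v hv

theorem setHeap_insert {a : V} {S : Finset V} (ha : ∀ b ∈ S, b < a) :
    setHeap G (insert a S) = Heap.mk [a] * setHeap G S := by
  rw [setHeap, Finset.sort_insert _ (fun b hb => (ha b hb).le) fun h => (ha a h).false,
    Heap.mk_cons, setHeap]

-- A stable set either avoids a or consists of a and a stable set of non-neighbours. Since `setHeap`
-- lists its elements in decreasing order, the largest vertex a factors out on the left.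
open Classical in
theorem stableGen_insert {a : V} {s : Finset V} (ha : ∀ b ∈ s, b < a) (x : Polynomial ℚ) :
    stableGen G (insert a s) x =
      stableGen G s x + x • (letterOp G a * stableGen G (s.filter fun b => ¬ G.Adj a b) x) := by
  have has : a ∉ s := fun h => (ha a h).false
  have hnot : ∀ S ∈ stableSets G (s.filter fun b => ¬ G.Adj a b), a ∉ S := fun S hS h =>
    has (Finset.filter_subset _ _ ((mem_stableSets.1 hS).1 h))
  rw [stableGen, stableSets_insert has, Finset.sum_union, stableGen,
    Finset.sum_image, stableGen, Finset.mul_sum, Finset.smul_sum]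
  · congr 1
    refine Finset.sum_congr rfl fun S hS => ?_
    rw [setHeap_insert fun b hb => ha b (Finset.filter_subset _ _ ((mem_stableSets.1 hS).1 hb)),
      Finset.card_insert_of_notMem (hnot S hS), map_mul, pow_succ', mul_smul, mul_smul_comm,
      Heap.op_mk, List.map_singleton, List.prod_singleton]
  · intro S hS U hU h
    have := congrArg (Finset.erase · a) h
    simpa [Finset.erase_insert (hnot S hS), Finset.erase_insert (hnot U hU)] using this
  · rw [Finset.disjoint_left]
    rintro S hS hU
    obtain ⟨U, -, rfl⟩ := Finset.mem_image.1 hU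
    exact has ((mem_stableSets.1 hS).1 (Finset.mem_insert_self a U))

/-- If `u < v < w` and `u, w` are adjacent then `v` is adjacent to both of them. -/
def IsIntervalLabelling (G : SimpleGraph V) : Prop :=
  ∀ u v w, u < v → v < w → G.Adj u w → G.Adj u v ∧ G.Adj v w

theorem stableGen_mul_letterOp_of_not_adj {a : V} {s : Finset V} (h : ∀ b ∈ s, ¬ G.Adj b a)
    (x : Polynomial ℚ) : stableGen G s x * letterOp G a = letterOp G a * stableGen G s x := by
  rw [stableGen, Finset.sum_mul, Finset.mul_sum]
  refine Finset.sum_congr rfl fun S hS => ?_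
  rw [smul_mul_assoc, mul_smul_comm]
  congr 1
  have hc : Commute (letterOp G a) ((S.sort (· ≥ ·)).map (letterOp G)).prod := by
    refine Commute.list_prod_right _ _ fun f hf => ?_
    obtain ⟨b, hb, rfl⟩ := List.mem_map.1 hf
    have hbs : b ∈ s := (mem_stableSets.1 hS).1 (by simpa using hb)
    exact letterOp_comm fun hh => h b hbs hh.symm
  exact hc.eq.symm

-- By the interval property the neighbours of a in s form a clique, so a stable set contains at most
-- one of them: with none it commutes with a, with one it picks up a single factor q.
open Classical in
theorem stableGen_mul_letterOp (hG : IsIntervalLabelling G) {a : V} {s : Finset V}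
    (ha : ∀ b ∈ s, b < a) (x : Polynomial ℚ) :
    stableGen G s x * letterOp G a =
      letterOp G a * (stableGen G (s.filter fun b => ¬ G.Adj a b) x +
        (Polynomial.X : Polynomial ℚ) •
          (stableGen G s x - stableGen G (s.filter fun b => ¬ G.Adj a b) x)) := by
  induction s using Finset.induction_on_max with
  | empty =>
    rw [Finset.filter_empty, sub_self, smul_zero, add_zero,
      stableGen_mul_letterOp_of_not_adj (by simp)]
  | insert b s hb ih =>
    have hba := ha b (Finset.mem_insert_self b s)
    by_cases hadj : G.Adj a b
    · have ih' := ih fun c hc => ha c (Finset.mem_insert_of_mem hc)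
      rw [Finset.filter_insert, if_neg (not_not.2 hadj), stableGen_insert hb, add_mul, ih',
        smul_mul_assoc, mul_assoc (letterOp G b), stableGen_mul_letterOp_of_not_adj,
        ← mul_assoc (letterOp G b), letterOp_mul_of_lt hadj.symm hba]
      · simp only [mul_add, mul_sub, mul_smul_comm, smul_mul_assoc, mul_assoc]
        module
      -- A neighbour c < b of a would also be adjacent to b, so the non-neighbours of b commute with
      -- a.
      · intro c hc hca
        rw [Finset.mem_filter] at hc
        exact hc.2 (hG c b a (hb c hc.1) hba hca).1.symm
    · have hall : ∀ c ∈ insert b s, ¬ G.Adj a c := by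
        intro c hc hac
        rcases Finset.mem_insert.1 hc with rfl | hc
        · exact hadj hac
        · exact hadj (hG c b a (hb c hc) hba hac.symm).2.symm
      rw [Finset.filter_true_of_mem hall, sub_self, smul_zero, add_zero,
        stableGen_mul_letterOp_of_not_adj fun c hc h => hall c hc h.symm]

theorem stableGen_empty (x : Polynomial ℚ) : stableGen G ∅ x = 1 := by
  have : stableSets G ∅ = {∅} := by
    ext S
    simp only [mem_stableSets, Finset.subset_empty, Finset.mem_singleton]
    exact ⟨fun h => h.1, fun h => by subst h; simp⟩
  rw [stableGen, this, Finset.sum_singleton, setHeap, Finset.sort_empty, Finset.card_empty,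
    pow_zero, one_smul]
  exact map_one Heap.op

/-- Commutation alone does not carry the induction: adding a largest vertex needs the exchange
relation with its non-neighbours, whose own extension needs the skew relation. All three are proved
together, the last two for initial segments s' of s whose complement in s is a clique. -/
theorem stableGen_relations (hG : IsIntervalLabelling G) (x z : Polynomial ℚ) (s : Finset V) :
    stableGen G s x * stableGen G s z = stableGen G s z * stableGen G s x ∧
    ∀ s' ⊆ s, (∀ u ∈ s', ∀ v ∈ s, v ∉ s' → u < v) →
      (∀ u ∈ s, ∀ v ∈ s, u ∉ s' → v ∉ s' → u ≠ v → G.Adj u v) →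
      ExchangeRel x z Polynomial.X (stableGen G s x) (stableGen G s z) (stableGen G s' x)
        (stableGen G s' z) ∧
      stableGen G s' x * stableGen G s z - stableGen G s z * stableGen G s' x +
        (stableGen G s x * stableGen G s' z - stableGen G s' z * stableGen G s x) = 0 := by
  classical
  induction s using Finset.strongInduction with
  | H s ih =>
  -- For s' = s both further relations reduce to commutation.
  have hself : stableGen G s x * stableGen G s z = stableGen G s z * stableGen G s x →
      ExchangeRel x z Polynomial.X (stableGen G s x) (stableGen G s z) (stableGen G s x)
        (stableGen G s z) ∧
      stableGen G s x * stableGen G s z - stableGen G s z * stableGen G s x +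
        (stableGen G s x * stableGen G s z - stableGen G s z * stableGen G s x) = 0 := by
    intro h
    refine ⟨?_, by rw [h]; abel⟩
    unfold ExchangeRel
    rw [h]
    module
  rcases s.eq_empty_or_nonempty with rfl | hne
  · have h : stableGen G ∅ x * stableGen G ∅ z = stableGen G ∅ z * stableGen G ∅ x := by
      rw [stableGen_empty, stableGen_empty]
    refine ⟨h, fun s' hs' _ _ => ?_⟩
    rw [Finset.subset_empty.1 hs']
    exact hself h
  obtain ⟨a, t, ha, rfl⟩ : ∃ a t, (∀ b ∈ t, b < a) ∧ s = insert a t := by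
    refine ⟨s.max' hne, s.erase (s.max' hne), fun b hb => ?_,
      (Finset.insert_erase (s.max'_mem hne)).symm⟩
    exact Finset.lt_max'_of_mem_erase_max' s hne hb
  have hat : a ∉ t := fun h => (ha a h).false
  -- The interval property makes l an initial segment of t with a clique as complement, and likewise
  -- of every s' with l ⊆ s' ⊆ t, so the induction hypothesis applies to all these pairs.
  set l := t.filter fun b => ¬ G.Adj a b with hl
  have hlt : l ⊆ t := Finset.filter_subset _ _
  have hlmem : ∀ {v}, v ∈ t → (v ∉ l ↔ G.Adj a v) := by
    intro v hv
    simp [hl, hv]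
  have hlower : ∀ s' ⊆ t, l ⊆ s' → ∀ u ∈ l, ∀ v ∈ s', v ∉ l → u < v := by
    intro s' hs' _ u hu v hv hvl
    have hav := (hlmem (hs' hv)).1 hvl
    by_contra hcon
    rcases (not_lt.1 hcon).eq_or_lt with rfl | hvu
    · exact hvl hu
    · exact (Finset.mem_filter.1 hu).2 (hG v u a hvu (ha u (hlt hu)) hav.symm).2.symm
  have hclique : ∀ s' ⊆ t, ∀ u ∈ s', ∀ v ∈ s', u ∉ l → v ∉ l → u ≠ v → G.Adj u v := by
    intro s' hs' u hu v hv hul hvl huv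
    have hau := (hlmem (hs' hu)).1 hul
    have hav := (hlmem (hs' hv)).1 hvl
    rcases lt_or_gt_of_ne huv with h | h
    · exact (hG u v a h (ha v (hs' hv)) hau.symm).1
    · exact (hG v u a h (ha u (hs' hu)) hav.symm).1.symm
  have hsub : ∀ s' ⊆ t, s' ⊂ insert a t := fun s' hs' =>
    lt_of_le_of_lt hs' (Finset.ssubset_insert hat)
  have hy : ∀ s' ⊆ t, l ⊆ s' → ∀ x, stableGen G s' x * letterOp G a = letterOp G a *
      (stableGen G l x + (Polynomial.X : Polynomial ℚ) • (stableGen G s' x - stableGen G l x)) := by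
    intro s' hs' hls' x
    have hfil : s'.filter (fun b => ¬ G.Adj a b) = l := by
      ext b
      simp only [hl, Finset.mem_filter]
      exact ⟨fun h => ⟨hs' h.1, h.2⟩, fun h => ⟨hls' (by simp [hl, h]), h.2⟩⟩
    rw [stableGen_mul_letterOp hG (fun b hb => ha b (hs' hb)), hfil]
  have hyl : ∀ x, stableGen G l x * letterOp G a = letterOp G a * stableGen G l x := fun x =>
    stableGen_mul_letterOp_of_not_adj (fun b hb h => (hlmem (hlt hb)).2 h.symm hb) x
  have hcomm : stableGen G (insert a t) x * stableGen G (insert a t) z =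
      stableGen G (insert a t) z * stableGen G (insert a t) x := by
    rw [stableGen_insert ha, stableGen_insert ha]
    have iht := ih t (hsub t subset_rfl)
    exact commute_extend (hy t subset_rfl hlt x) (hy t subset_rfl hlt z) (hyl x) (hyl z) iht.1
      (ih l (hsub l hlt)).1
      (iht.2 l hlt (hlower t subset_rfl hlt) (hclique t subset_rfl)).1
  refine ⟨hcomm, fun s' hs' h1 h2 => ?_⟩
  by_cases has' : a ∈ s'
  · have hs : s' = insert a t := by
      refine Finset.Subset.antisymm hs' fun v hv => ?_
      by_contra hvs
      rcases Finset.mem_insert.1 hv with rfl | hvt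
      · exact hvs has'
      · exact (ha v hvt).not_gt (h1 a has' v hv hvs)
    rw [hs]
    exact hself hcomm
  · have hs't : s' ⊆ t := (Finset.subset_insert_iff_of_notMem has').1 hs'
    -- A vertex of l outside s' would lie with a in the clique s ∖ s', although it is not adjacent
    -- to a.
    have hls' : l ⊆ s' := by
      intro v hv
      by_contra hvs
      exact (Finset.mem_filter.1 hv).2 (h2 a (Finset.mem_insert_self a t) v
        (Finset.mem_insert_of_mem (hlt hv)) has' hvs fun h => hat (h ▸ hlt hv))
    have iht := (ih t (hsub t subset_rfl)).2 s' hs't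
      (fun u hu v hv => h1 u hu v (Finset.mem_insert_of_mem hv))
      (fun u hu v hv => h2 u (Finset.mem_insert_of_mem hu) v (Finset.mem_insert_of_mem hv))
    have ihs' := (ih s' (hsub s' hs't)).2 l hls' (hlower s' hs't hls') (hclique s' hs't)
    rw [stableGen_insert ha, stableGen_insert ha]
    exact ⟨exchangeRel_extend (hy s' hs't hls' x) (hy s' hs't hls' z) (ih l (hsub l hlt)).1
      ihs'.2 iht.1, skewCommute_extend (hy s' hs't hls' x) (hy s' hs't hls' z) iht.2 ihs'.1⟩

theorem stableGen_commute (hG : IsIntervalLabelling G) (x z : Polynomial ℚ) (s : Finset V) :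
    Commute (stableGen G s x) (stableGen G s z) :=
  (stableGen_relations hG x z s).1

variable [Fintype V]

theorem stableGen_univ_eq_sum (x : Polynomial ℚ) :
    stableGen G Finset.univ x =
      ∑ k ∈ Finset.range (Fintype.card V + 1), x ^ k • stableSum G k := by
  rw [stableGen, ← Finset.sum_fiberwise_of_maps_to (g := Finset.card)
    (t := Finset.range (Fintype.card V + 1))
    fun S _ => Finset.mem_range.2 (Nat.lt_succ_of_le (Finset.card_le_univ S))]
  refine Finset.sum_congr rfl fun k _ => ?_
  rw [stableSum, Finset.smul_sum]
  refine Finset.sum_congr rfl fun S hS => ?_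
  rw [(Finset.mem_filter.1 hS).2]

theorem stableSum_eq_zero {k : ℕ} (hk : Fintype.card V < k) : stableSum G k = 0 := by
  rw [stableSum, Finset.filter_false_of_mem, Finset.sum_empty]
  exact fun S _ h => (Finset.card_le_univ S).not_gt (h ▸ hk)

/-- Coefficients are extracted from the commuting generating functions first in x, then in z; the
values at all scalars of ℚ[q] suffice for this. -/
theorem stableSum_commute (hG : IsIntervalLabelling G) (i j : ℕ) :
    stableSum G i * stableSum G j = stableSum G j * stableSum G i := by
  rcases lt_or_ge (Fintype.card V) i with hi | hi
  · rw [stableSum_eq_zero hi, zero_mul, mul_zero]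
  rcases lt_or_ge (Fintype.card V) j with hj | hj
  · rw [stableSum_eq_zero hj, zero_mul, mul_zero]
  have h1 : ∀ z k, k < Fintype.card V + 1 →
      stableSum G k * stableGen G Finset.univ z - stableGen G Finset.univ z * stableSum G k = 0 := by
    intro z
    refine eq_zero_of_sum_pow_smul_eq_zero _ fun x => ?_
    have := sub_eq_zero.2 (stableGen_commute hG x z Finset.univ).eq
    rw [stableGen_univ_eq_sum x, Finset.sum_mul, Finset.mul_sum, ← Finset.sum_sub_distrib] at this
    simpa only [smul_sub, smul_mul_assoc, mul_smul_comm] using this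
  refine sub_eq_zero.1 (eq_zero_of_sum_pow_smul_eq_zero (n := Fintype.card V + 1)
    (fun k => stableSum G i * stableSum G k - stableSum G k * stableSum G i) (fun z => ?_) j
    (Nat.lt_succ_of_le hj))
  have := h1 z i (Nat.lt_succ_of_le hi)
  rw [stableGen_univ_eq_sum z, Finset.sum_mul, Finset.mul_sum, ← Finset.sum_sub_distrib] at this
  simpa only [smul_sub, smul_mul_assoc, mul_smul_comm] using this

end

/-- If v were not adjacent to u, then u <_P v. Either w is incomparable to both, and the labelling
puts w before v, or v <_P w, and transitivity makes u, w comparable. The other adjacency is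
symmetric. -/
theorem isIntervalLabelling_incompGraph {V : Type*} [L : LinearOrder V] {P : PartialOrder V}
    (h : IsNaturalLabelling P) : IsIntervalLabelling (incompGraph P) := by
  have hlt : ∀ {u v : V}, L.lt u v → ¬ (incompGraph P).Adj u v → P.lt u v := by
    intro u v huv hadj
    have hne : u ≠ v := @LT.lt.ne V L.toPreorder u v huv
    by_contra hcon
    have h1 : ¬ P.le u v := fun hle => hcon ((@lt_iff_le_and_ne V P u v).2 ⟨hle, hne⟩)
    have h2 : ¬ P.le v u := fun hle => @lt_asymm V L.toPreorder u v huv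
      (h.1 v u ((@lt_iff_le_and_ne V P v u).2 ⟨hle, hne.symm⟩))
    exact hadj ⟨h1, h2⟩
  have hle : ∀ {u v w : V}, P.lt u v → P.lt v w → P.le u w := fun h1 h2 =>
    @le_of_lt V P.toPreorder _ _ (@lt_trans V P.toPreorder _ _ _ h1 h2)
  intro u v w huv hvw huw
  constructor
  · by_contra hcon
    have h1 := hlt huv hcon
    by_cases hvw' : (incompGraph P).Adj v w
    · exact @lt_asymm V L.toPreorder _ _ hvw (h.2 u w v h1 huw.symm hvw'.symm).2
    · exact huw.1 (hle h1 (hlt hvw hvw'))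
  · by_contra hcon
    have h1 := hlt hvw hcon
    by_cases huv' : (incompGraph P).Adj u v
    · exact @lt_asymm V L.toPreorder _ _ huv (h.2 v u w h1 huv' huw).1
    · exact huw.1 (hle (hlt huv huv') h1)

end Kromatic

namespace Kromatic

noncomputable section

/-! ### The commutative algebra generated by the sums of stable sets -/

/-- Let P(t), D(t) and E(-t) be the series of p_k, (-1)^(k+1) k e_k and (-1)^k e_k. The hypotheses
say E(-t)H(t) = 1 and D(t)H(t) = P(t), so P(t)E(-t) = D(t), which is Newton's identity up to sign.
-/
theorem newton_of_inverse {C : Type*} [CommRing C] {e h p : ℕ → C}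
    (h1 : ∀ n : ℕ, ∑ a ∈ Finset.HasAntidiagonal.antidiagonal n, (-1 : ℤ) ^ a.1 • (e a.1 * h a.2) =
      if n = 0 then 1 else 0)
    (h2 : ∀ n : ℕ, ∑ a ∈ Finset.HasAntidiagonal.antidiagonal n,
      ((-1 : ℤ) ^ (a.1 + 1) * a.1) • (e a.1 * h a.2) = p n) (n : ℕ) :
    (n : C) * e n =
      ∑ a ∈ Finset.HasAntidiagonal.antidiagonal n, (-1) ^ (a.1 + 1) * p a.1 * e a.2 := by
  have h1' : (PowerSeries.mk fun k => (-1) ^ k * e k) * PowerSeries.mk h = 1 := by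
    ext n
    rw [PowerSeries.coeff_mul, PowerSeries.coeff_one, ← h1 n]
    refine Finset.sum_congr rfl fun a _ => ?_
    simp [mul_assoc]
  have h2' : (PowerSeries.mk fun k => (-1) ^ (k + 1) * (k : C) * e k) * PowerSeries.mk h =
      PowerSeries.mk p := by
    ext n
    rw [PowerSeries.coeff_mul, PowerSeries.coeff_mk, ← h2 n]
    refine Finset.sum_congr rfl fun a _ => ?_
    simp [mul_assoc]
  have h3 : PowerSeries.mk p * (PowerSeries.mk fun k => (-1) ^ k * e k) =
      PowerSeries.mk fun k => (-1) ^ (k + 1) * (k : C) * e k := by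
    rw [← h2', mul_assoc, mul_comm (PowerSeries.mk h), h1', mul_one]
  have h4 := congrArg (PowerSeries.coeff n) h3
  rw [PowerSeries.coeff_mul, PowerSeries.coeff_mk] at h4
  have h5 := congrArg ((-1) ^ (n + 1) * ·) h4
  simp only [← mul_assoc, ← pow_add, PowerSeries.coeff_mk] at h5
  rw [← two_mul, pow_mul, neg_one_sq, one_pow, one_mul] at h5
  rw [← h5, Finset.mul_sum]
  refine Finset.sum_congr rfl fun a ha => ?_
  rw [Finset.HasAntidiagonal.mem_antidiagonal] at ha
  have h6 : ((-1) ^ (n + 1) * (-1) ^ a.2 : C) = (-1) ^ (a.1 + 1) := by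
    rw [← pow_add, ← ha, show a.1 + a.2 + 1 + a.2 = a.1 + 1 + 2 * a.2 by ring, pow_add, pow_mul,
      neg_one_sq, one_pow, mul_one]
  rw [← h6]
  ring

universe u

variable {V : Type u} [LinearOrder V] [Fintype V] {G : SimpleGraph V}

open scoped IsMulCommutative in
/-- The sums of the stable sets and of the pyramids come from a commutative algebra, in which
they are related like elementary symmetric functions and power sums. -/
theorem exists_commRing_model (hG : IsIntervalLabelling G) :
    ∃ (C : Type u) (_ : CommRing C) (_ : Algebra ℚ C) (φ : C →ₐ[ℚ] TorusEnd V) (e p : ℕ → C),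
      (∀ k, φ (e k) = stableSum G k) ∧ (∀ k, φ (p k) = pyramidOp G k) ∧ e 0 = 1 ∧ p 0 = 0 ∧
      ∀ n : ℕ, (n : C) * e n =
        ∑ a ∈ Finset.HasAntidiagonal.antidiagonal n, (-1) ^ (a.1 + 1) * p a.1 * e a.2 := by
  set S : Subalgebra ℚ (TorusEnd V) := Algebra.adjoin ℚ (Set.range (stableSum G)) with hS
  have hcomm : IsMulCommutative S := Algebra.isMulCommutative_adjoin ℚ (by
    rintro _ ⟨i, rfl⟩ _ ⟨j, rfl⟩
    exact stableSum_commute hG i j)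
  have he : ∀ k, stableSum G k ∈ S := fun k => Algebra.subset_adjoin ⟨k, rfl⟩
  have hh : ∀ n, heapSum G n ∈ S := by
    intro n
    induction n using Nat.strong_induction_on with
    | _ n ih =>
    -- As e_0 = 1, the inversion formula expresses h_n through the e_k and the earlier h_j.
    have h := sum_stableSum_mul_heapSum_eq_ite G n
    rw [Finset.Nat.sum_antidiagonal_eq_sum_range_succ_mk, Finset.sum_range_succ'] at h
    simp only [pow_zero, one_smul, stableSum_zero, one_mul, Nat.sub_zero] at h
    rw [eq_sub_of_add_eq' h]
    refine S.sub_mem ?_ (S.sum_mem fun k hk => ?_)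
    · split_ifs
      · exact S.one_mem
      · exact S.zero_mem
    · rw [Finset.mem_range] at hk
      exact S.zsmul_mem (S.mul_mem (he _) (ih _ (by omega))) _
  have hp : ∀ n, pyramidOp G n ∈ S := by
    intro n
    rw [← sum_stableSum_mul_heapSum_eq_pyramidOp]
    exact S.sum_mem fun a _ => S.zsmul_mem (S.mul_mem (he _) (hh _)) _
  let e : ℕ → S := fun k => ⟨stableSum G k, he k⟩
  let h : ℕ → S := fun k => ⟨heapSum G k, hh k⟩
  let p : ℕ → S := fun k => ⟨pyramidOp G k, hp k⟩
  refine ⟨S, inferInstance, inferInstance, S.val, e, p, fun k => rfl, fun k => rfl, ?_, ?_, ?_⟩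
  · exact Subtype.ext (stableSum_zero G)
  · refine Subtype.ext ?_
    change pyramidOp G 0 = 0
    rw [← sum_stableSum_mul_heapSum_eq_pyramidOp]
    simp
  · refine newton_of_inverse (h := h) (fun n => Subtype.ext ?_) fun n => Subtype.ext ?_
    · change S.val _ = S.val _
      rw [map_sum, apply_ite S.val, map_one, map_zero, ← sum_stableSum_mul_heapSum_eq_ite G n]
      simp only [map_zsmul, map_mul]
      rfl
    · change S.val _ = pyramidOp G n
      rw [map_sum, ← sum_stableSum_mul_heapSum_eq_pyramidOp G n]
      simp only [map_zsmul, map_mul]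
      rfl

end

end Kromatic

namespace Kromatic

noncomputable section

/-! ### The coefficients of the Kromatic function -/

namespace Heap

variable {V : Type*} {G : SimpleGraph V}

/-- The multiset of the vertices of the pieces. -/
def content : Heap G →* Multiplicative (Multiset V) where
  toFun := Quot.lift (fun w => Multiplicative.ofAdd (w : Multiset V)) (by
    rintro _ _ ⟨a, b, u, v, _, _⟩
    exact congrArg _ (Multiset.coe_eq_coe.2 ((List.Perm.swap v u b).append_left a)))
  map_one' := rfl
  map_mul' := by
    rintro ⟨a⟩ ⟨b⟩
    rfl

theorem uses_iff (H : Heap G) (v : V) : H.Uses v ↔ v ∈ (content H).toAdd := by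
  obtain ⟨w⟩ := H
  exact Iff.rfl

variable [LinearOrder V]

/-- Ascents between the factors depend only on their contents, so stacked stable sets can be treated
by pairs of layers. -/
theorem asc_mul (H K : Heap G) : (H * K).asc = H.asc + K.asc +
    ((content H).toAdd.map fun u => crossing G u (content K).toAdd).sum := by
  obtain ⟨a⟩ := H
  obtain ⟨b⟩ := K
  change wordAsc G (a ++ b) = wordAsc G a + wordAsc G b +
    ((a : Multiset V).map fun u => crossing G u (b : Multiset V)).sum
  induction a with
  | nil => simp [wordAsc]
  | cons u a ih =>
    rw [List.cons_append, wordAsc, wordAsc, ih, List.countP_append, ← Multiset.cons_coe,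
      Multiset.map_cons, Multiset.sum_cons, crossing, Multiset.coe_countP]
    ring

end Heap

variable {V : Type*} [LinearOrder V]

theorem asc_setHeap {G : SimpleGraph V} {S : Finset V} (hS : ∀ u ∈ S, ∀ v ∈ S, ¬ G.Adj u v) :
    (setHeap G S).asc = 0 := by
  have h : ∀ w : List V, (∀ u ∈ w, ∀ v ∈ w, ¬ G.Adj u v) → Heap.wordAsc G w = 0 := by
    intro w
    induction w with
    | nil => exact fun _ => rfl
    | cons u w ih =>
      intro hw
      rw [Heap.wordAsc, ih fun a ha b hb => hw a (by simp [ha]) b (by simp [hb]), add_zero,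
        List.countP_eq_zero]
      intro v hv
      simp [hw u (by simp) v (by simp [hv])]
  exact h _ fun u hu v hv => hS u (by simpa using hu) v (by simpa using hv)

theorem content_setHeap (G : SimpleGraph V) (S : Finset V) :
    (Heap.content (setHeap G S)).toAdd = S.val :=
  Finset.sort_eq (r := (· ≥ ·)) S

theorem content_prod_setHeap (G : SimpleGraph V) {N : ℕ} (g : Fin N → Finset V) :
    (Heap.content (List.ofFn fun i => setHeap G (g i)).prod).toAdd = ∑ i, (g i).val := by
  induction N with
  | zero => simp
  | succ N ih =>
    rw [List.ofFn_succ, List.prod_cons, map_mul, toAdd_mul, ih, content_setHeap, Fin.sum_univ_succ]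

theorem crossing_sum (G : SimpleGraph V) (u : V) {N : ℕ} (f : Fin N → Multiset V) :
    crossing G u (∑ i, f i) = ∑ i, crossing G u (f i) := by
  classical
  exact map_sum (Multiset.countPAddMonoidHom fun v => G.Adj u v ∧ u < v) f Finset.univ

theorem asc_prod_setHeap {G : SimpleGraph V} {N : ℕ} {g : Fin N → Finset V}
    (hg : ∀ i, ∀ u ∈ g i, ∀ v ∈ g i, ¬ G.Adj u v) :
    (List.ofFn fun i => setHeap G (g i)).prod.asc =
      ∑ i, ∑ j, if i < j then ∑ u ∈ g i, crossing G u (g j).val else 0 := by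
  induction N with
  | zero => rfl
  | succ N ih =>
    rw [List.ofFn_succ, List.prod_cons, Heap.asc_mul, asc_setHeap (hg 0),
      ih fun i => hg i.succ, content_setHeap, content_prod_setHeap]
    simp only [Fin.sum_univ_succ, crossing_sum, Fin.succ_lt_succ_iff, Fin.not_lt_zero, if_false,
      Fin.succ_pos, if_true, zero_add]
    rw [add_comm, Finset.sum_comm (s := Finset.univ) (t := g 0)]
    rfl

/-- The set coloring with given color classes. -/
def coloringOf {N : ℕ} (g : Fin N → Finset V) (v : V) : Finset ℕ :=
  (Finset.univ.filter fun i => v ∈ g i).map Fin.valEmbedding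

theorem mem_coloringOf {N : ℕ} {g : Fin N → Finset V} {v : V} {k : ℕ} :
    k ∈ coloringOf g v ↔ ∃ i : Fin N, v ∈ g i ∧ (i : ℕ) = k := by
  simp [coloringOf]

theorem val_mem_coloringOf {N : ℕ} {g : Fin N → Finset V} {v : V} {i : Fin N} :
    (i : ℕ) ∈ coloringOf g v ↔ v ∈ g i := by
  rw [mem_coloringOf]
  exact ⟨fun ⟨j, hj, h⟩ => Fin.val_injective h ▸ hj, fun h => ⟨i, h, rfl⟩⟩

theorem isProperSetColoring_coloringOf_iff (G : SimpleGraph V) {N : ℕ} (g : Fin N → Finset V) :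
    IsProperSetColoring G (coloringOf g) ↔
      (∀ v, ∃ i, v ∈ g i) ∧ ∀ i, ∀ u ∈ g i, ∀ v ∈ g i, ¬ G.Adj u v := by
  refine and_congr (forall_congr' fun v => ?_) ?_
  · constructor
    · rintro ⟨k, hk⟩
      obtain ⟨i, hi, -⟩ := mem_coloringOf.1 hk
      exact ⟨i, hi⟩
    · rintro ⟨i, hi⟩
      exact ⟨i, val_mem_coloringOf.2 hi⟩
  · constructor
    · intro h i u hu v hv huv
      exact Finset.disjoint_left.1 (h u v huv) (val_mem_coloringOf.2 hu) (val_mem_coloringOf.2 hv)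
    · intro h u v huv
      rw [Finset.disjoint_left]
      intro k hk hk'
      obtain ⟨i, hi, rfl⟩ := mem_coloringOf.1 hk
      exact h i u hi v (val_mem_coloringOf.1 hk') huv

theorem coloringOf_injective {N : ℕ} :
    Function.Injective (coloringOf : (Fin N → Finset V) → V → Finset ℕ) := by
  intro g g' h
  funext i
  ext v
  rw [← val_mem_coloringOf, h, val_mem_coloringOf]

variable [Fintype V]

theorem colorContent_apply {V : Type*} [Fintype V] (κ : V → Finset ℕ) (k : ℕ) :
    colorContent κ k = (Finset.univ.filter fun v => k ∈ κ v).card := by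
  rw [colorContent, Finsupp.finsetSum_apply, Finset.card_filter]
  refine Finset.sum_congr rfl fun v _ => ?_
  rw [Finsupp.finsetSum_apply]
  simp [Finsupp.single_apply]

/-- The right side is the ascent number of the stacked color classes, as in `asc_prod_setHeap`: both
count adjacent u < v with u in an earlier class than v. -/
theorem colorAsc_coloringOf (G : SimpleGraph V) {N : ℕ} (g : Fin N → Finset V) :
    colorAsc G (coloringOf g) =
      ∑ i, ∑ j, if i < j then ∑ u ∈ g i, crossing G u (g j).val else 0 := by
  classical
  have hsum : ∀ (v : V) (f : ℕ → ℕ), ∑ k ∈ coloringOf g v, f k =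
      ∑ i : Fin N, if v ∈ g i then f i else 0 := by
    intro v f
    rw [coloringOf, Finset.sum_map, Finset.sum_filter]
    rfl
  have h1 : ∀ e : V × V, (((coloringOf g e.1 ×ˢ coloringOf g e.2).filter
      fun p => p.1 < p.2).card) = ∑ i : Fin N, ∑ j : Fin N,
        if i < j then (if e.1 ∈ g i then if e.2 ∈ g j then 1 else 0 else 0) else 0 := by
    intro e
    rw [Finset.card_filter, Finset.sum_product, hsum]
    refine Finset.sum_congr rfl fun i _ => ?_
    by_cases h : e.1 ∈ g i
    · rw [if_pos h, hsum]
      refine Finset.sum_congr rfl fun j _ => ?_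
      by_cases h' : i < j <;> simp [h, h']
    · simp [h]
  have h2 : ∀ i j : Fin N, ∑ u ∈ g i, crossing G u (g j).val =
      ∑ e : V × V with G.Adj e.1 e.2 ∧ e.1 < e.2,
        if e.1 ∈ g i then if e.2 ∈ g j then 1 else 0 else 0 := by
    intro i j
    have hmem : ∀ (S : Finset V) (f : V → ℕ), ∑ u ∈ S, f u = ∑ u, if u ∈ S then f u else 0 := by
      intro S f
      rw [Finset.sum_ite_mem, Finset.univ_inter]
    have h3 : ∀ u, crossing G u (g j).val =
        ∑ v, if v ∈ g j then if G.Adj u v ∧ u < v then 1 else 0 else 0 := by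
      intro u
      rw [← hmem, ← Finset.card_filter, crossing, Multiset.countP_eq_card_filter]
      rfl
    rw [Finset.sum_filter, Fintype.sum_prod_type, hmem]
    refine Finset.sum_congr rfl fun u _ => ?_
    by_cases hu : u ∈ g i
    · rw [if_pos hu, h3]
      refine Finset.sum_congr rfl fun v _ => ?_
      simp only [hu, if_true]
      split_ifs <;> rfl
    · simp [hu]
  unfold colorAsc
  simp only [h1, h2]
  rw [Finset.sum_comm]
  refine Finset.sum_congr rfl fun i _ => ?_
  rw [Finset.sum_comm]
  refine Finset.sum_congr rfl fun j _ => ?_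
  split_ifs <;> simp

theorem colorContent_coloringOf_eq_iff {N : ℕ} {m : ℕ →₀ ℕ} (hm : m.support ⊆ Finset.range N)
    (g : Fin N → Finset V) : colorContent (coloringOf g) = m ↔ ∀ i, (g i).card = m i := by
  have h : ∀ i : Fin N, colorContent (coloringOf g) i = (g i).card := by
    intro i
    rw [colorContent_apply]
    congr 1
    ext v
    simp [val_mem_coloringOf]
  constructor
  · rintro rfl i
    exact (h i).symm
  · intro hg
    ext k
    by_cases hk : k < N
    · exact (h ⟨k, hk⟩).trans (hg ⟨k, hk⟩)
    · rw [Finsupp.notMem_support_iff.1 fun hh => hk (Finset.mem_range.1 (hm hh)),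
        colorContent_apply, Finset.card_eq_zero, Finset.filter_eq_empty_iff]
      intro v _ hv
      obtain ⟨i, -, rfl⟩ := mem_coloringOf.1 hv
      exact hk i.2

theorem exists_coloringOf_eq {N : ℕ} {κ : V → Finset ℕ}
    (hκ : (colorContent κ).support ⊆ Finset.range N) :
    ∃ g : Fin N → Finset V, coloringOf g = κ := by
  refine ⟨fun i => Finset.univ.filter fun v => (i : ℕ) ∈ κ v, funext fun v => ?_⟩
  ext k
  rw [mem_coloringOf]
  constructor
  · rintro ⟨i, hi, rfl⟩
    simpa using hi
  · intro hk
    have hkN : k ∈ Finset.range N := by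
      refine hκ (Finsupp.mem_support_iff.2 ?_)
      rw [colorContent_apply]
      exact (Finset.card_pos.2 ⟨v, by simpa using hk⟩).ne'
    exact ⟨⟨k, Finset.mem_range.1 hkN⟩, by simpa using hk, rfl⟩

/-- Expanding the product picks a stable set of size m i for each color i. Those choices that cover
V are exactly the color classes of the proper set colorings of content m, with the same ascents. -/
theorem coeff_kromatic (G : SimpleGraph V) {N : ℕ} {m : ℕ →₀ ℕ}
    (hm : m.support ⊆ Finset.range N) :
    MvPowerSeries.coeff m (kromatic G) =
      coverSum (List.ofFn fun i : Fin N => stableSum G (m i)).prod := by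
  classical
  have h1 : (List.ofFn fun i : Fin N => stableSum G (m i)).prod =
      ∑ g ∈ Fintype.piFinset fun i : Fin N => {S ∈ stableSets G Finset.univ | S.card = m i},
        Heap.op (List.ofFn fun i => setHeap G (g i)).prod := by
    have := (MultilinearMap.mkPiAlgebraFin ℚ N (TorusEnd V)).map_sum_finset
      (fun _ S => Heap.op (setHeap G S))
      (fun i : Fin N => {S ∈ stableSets G Finset.univ | S.card = m i})
    simp only [MultilinearMap.mkPiAlgebraFin_apply] at this
    refine this.trans (Finset.sum_congr rfl fun g _ => ?_)
    rw [map_list_prod, List.map_ofFn]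
    rfl
  rw [h1, map_sum, Finset.sum_congr rfl fun g _ => coverSum_op _, ← Finset.sum_filter]
  change ∑ᶠ κ ∈ {κ : V → Finset ℕ | IsProperSetColoring G κ ∧ colorContent κ = m},
    (Polynomial.X : Polynomial ℚ) ^ colorAsc G κ = _
  rw [finsum_mem_eq_finite_toFinset_sum _ (finite_colorings G m)]
  symm
  have hmem : ∀ g : Fin N → Finset V,
      g ∈ ((Fintype.piFinset fun i : Fin N => {S ∈ stableSets G Finset.univ | S.card = m i}).filter
        fun g => ∀ v, (List.ofFn fun i => setHeap G (g i)).prod.Uses v) ↔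
      IsProperSetColoring G (coloringOf g) ∧ colorContent (coloringOf g) = m := by
    intro g
    rw [isProperSetColoring_coloringOf_iff, colorContent_coloringOf_eq_iff hm]
    simp only [Finset.mem_filter, Fintype.mem_piFinset, mem_stableSets, Finset.subset_univ,
      true_and, Heap.uses_iff, content_prod_setHeap, Multiset.mem_sum, Finset.mem_univ,
      Finset.mem_val, forall_and]
    tauto
  refine Finset.sum_bij (fun g _ => coloringOf g) ?_ ?_ ?_ ?_
  · intro g hg
    rw [Set.Finite.mem_toFinset]
    exact (hmem g).1 hg
  · exact fun g _ g' _ h => coloringOf_injective h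
  · intro κ hκ
    rw [Set.Finite.mem_toFinset] at hκ
    obtain ⟨g, rfl⟩ := exists_coloringOf_eq (N := N) (κ := κ) (by rw [hκ.2]; exact hm)
    exact ⟨g, (hmem g).2 hκ, rfl⟩
  · intro g hg
    rw [colorAsc_coloringOf, asc_prod_setHeap]
    exact ((isProperSetColoring_coloringOf_iff G g).1 ((hmem g).1 hg).1).2

end

end Kromatic

namespace Kromatic

noncomputable section

/-! ### Sums over partitions weighted by `1 / z_λ` -/

/-- `∏ₖ k ^ iₖ * iₖ!` for a multiset with `iₖ` copies of `k`. -/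
def zee (s : Multiset ℕ) : ℕ := ∏ k ∈ s.toFinset, k ^ s.count k * (s.count k).factorial

theorem zee_eq_prod {s : Multiset ℕ} {F : Finset ℕ} (h : s.toFinset ⊆ F) :
    zee s = ∏ k ∈ F, k ^ s.count k * (s.count k).factorial := by
  refine Finset.prod_subset h fun k _ hk => ?_
  rw [Multiset.count_eq_zero.2 fun hh => hk (Multiset.mem_toFinset.2 hh)]
  rfl

theorem zee_cons (k : ℕ) (s : Multiset ℕ) :
    zee (k ::ₘ s) = k * (s.count k + 1) * zee s := by
  have hk : k ∈ insert k s.toFinset := Finset.mem_insert_self _ _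
  rw [zee_eq_prod (s := k ::ₘ s) (F := insert k s.toFinset) (by simp),
    zee_eq_prod (s := s) (F := insert k s.toFinset) (Finset.subset_insert _ _),
    ← Finset.mul_prod_erase _ _ hk, ← Finset.mul_prod_erase _ _ hk, Multiset.count_cons_self,
    pow_succ, Nat.factorial_succ]
  have : ∀ j ∈ (insert k s.toFinset).erase k,
      j ^ (k ::ₘ s).count j * ((k ::ₘ s).count j).factorial =
        j ^ s.count j * (s.count j).factorial := by
    intro j hj
    rw [Multiset.count_cons_of_ne (Finset.ne_of_mem_erase hj)]
  rw [Finset.prod_congr rfl this]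
  ring

theorem zee_pos {s : Multiset ℕ} (hs : ∀ k ∈ s, 0 < k) : 0 < zee s :=
  Finset.prod_pos fun k hk =>
    Nat.mul_pos (pow_pos (hs k (Multiset.mem_toFinset.1 hk)) _) (Nat.factorial_pos _)

/-- The partitions of `n` as multisets. -/
def partitionsOf (n : ℕ) : Finset (Multiset ℕ) :=
  Finset.univ.image (Nat.Partition.parts : n.Partition → Multiset ℕ)

theorem mem_partitionsOf {n : ℕ} {s : Multiset ℕ} :
    s ∈ partitionsOf n ↔ s.sum = n ∧ ∀ k ∈ s, 0 < k := by
  simp only [partitionsOf, Finset.mem_image, Finset.mem_univ, true_and]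
  constructor
  · rintro ⟨p, rfl⟩
    exact ⟨p.parts_sum, fun k hk => p.parts_pos hk⟩
  · rintro ⟨h1, h2⟩
    exact ⟨⟨s, fun hk => h2 _ hk, h1⟩, rfl⟩

variable {R : Type*} [CommRing R] [Algebra ℚ R]

/-- `∑_{λ ⊢ n} z_λ⁻¹ ∏ᵢ A_{λᵢ}`. -/
def cycleSum (A : ℕ → R) (n : ℕ) : R :=
  ∑ s ∈ partitionsOf n, (zee s : ℚ)⁻¹ • (s.map A).prod

theorem cycleSum_zero (A : ℕ → R) : cycleSum A 0 = 1 := by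
  have : partitionsOf 0 = {0} := by
    ext s
    rw [mem_partitionsOf, Finset.mem_singleton]
    constructor
    · rintro ⟨h1, h2⟩
      refine Multiset.eq_zero_of_forall_notMem fun k hk => ?_
      have := Multiset.single_le_sum (fun _ _ => Nat.zero_le _) k hk
      have := h2 k hk
      omega
    · rintro rfl
      simp
  rw [cycleSum, this, Finset.sum_singleton]
  simp [zee]

/-- Write n as the sum of k times the multiplicity of k; this factor is the quotient of z_λ by the z
of λ with one part k removed. -/
theorem natCast_mul_cycleSum (A : ℕ → R) (hA : A 0 = 0) (n : ℕ) :
    (n : R) * cycleSum A n = ∑ k ∈ Finset.range (n + 1), A k * cycleSum A (n - k) := by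
  have hl : (n : R) * cycleSum A n = ∑ s ∈ partitionsOf n, ∑ k ∈ s.toFinset,
      A k * (zee (s.erase k) : ℚ)⁻¹ • ((s.erase k).map A).prod := by
    rw [cycleSum, Finset.mul_sum]
    refine Finset.sum_congr rfl fun s hs => ?_
    rw [mem_partitionsOf] at hs
    have hn : (n : R) = ∑ k ∈ s.toFinset, ((s.count k : ℚ) * k) • (1 : R) := by
      rw [← hs.1, Finset.sum_multiset_count, Nat.cast_sum]
      refine Finset.sum_congr rfl fun k _ => ?_
      rw [smul_eq_mul, Nat.cast_mul, ← Algebra.algebraMap_eq_smul_one, map_mul, map_natCast,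
        map_natCast]
    rw [hn, Finset.sum_mul]
    refine Finset.sum_congr rfl fun k hk => ?_
    rw [Multiset.mem_toFinset] at hk
    obtain ⟨t, rfl⟩ := Multiset.exists_cons_of_mem hk
    have hk0 : (k : ℚ) ≠ 0 := by exact_mod_cast (hs.2 k hk).ne'
    have ht0 : (zee t : ℚ) ≠ 0 := by
      exact_mod_cast (zee_pos fun j hj => hs.2 j (Multiset.mem_cons_of_mem hj)).ne'
    have hc0 : ((t.count k : ℚ) + 1) ≠ 0 := by positivity
    rw [Multiset.erase_cons_head, Multiset.map_cons, Multiset.prod_cons, smul_mul_assoc, one_mul,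
      smul_smul, mul_smul_comm, zee_cons, Multiset.count_cons_self]
    congr 1
    push_cast
    field_simp
  -- Partitions have no part 0, so the term k = 0 must be discarded; `hA` allows it.
  have hr : ∑ k ∈ Finset.range (n + 1), A k * cycleSum A (n - k) =
      ∑ k ∈ (Finset.range (n + 1)).erase 0, ∑ t ∈ partitionsOf (n - k),
        A k * (zee t : ℚ)⁻¹ • (t.map A).prod := by
    rw [← Finset.add_sum_erase _ _ (Finset.mem_range.2 n.succ_pos), hA, zero_mul, zero_add]
    simp only [cycleSum, Finset.mul_sum]
  rw [hl, hr, Finset.sum_sigma', Finset.sum_sigma']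
  refine Finset.sum_bij' (fun x _ => ⟨x.2, x.1.erase x.2⟩) (fun y _ => ⟨y.1 ::ₘ y.2, y.1⟩)
    ?_ ?_ ?_ ?_ ?_
  · rintro ⟨s, k⟩ h
    simp only [Finset.mem_sigma, mem_partitionsOf, Multiset.mem_toFinset, Finset.mem_erase,
      Finset.mem_range] at h ⊢
    obtain ⟨⟨h1, h2⟩, hk⟩ := h
    have hsum := Multiset.sum_erase hk
    have := h2 k hk
    refine ⟨⟨by omega, by omega⟩, by omega, fun j hj => h2 j (Multiset.mem_of_mem_erase hj)⟩
  · rintro ⟨k, t⟩ h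
    simp only [Finset.mem_sigma, mem_partitionsOf, Multiset.mem_toFinset, Finset.mem_erase,
      Finset.mem_range] at h ⊢
    obtain ⟨⟨h0, h1⟩, h2, h3⟩ := h
    refine ⟨⟨by rw [Multiset.sum_cons]; omega, fun j hj => ?_⟩, Multiset.mem_cons_self k t⟩
    rcases Multiset.mem_cons.1 hj with rfl | hj
    · omega
    · exact h3 j hj
  · rintro ⟨s, k⟩ h
    simp only [Finset.mem_sigma, Multiset.mem_toFinset] at h
    simp [Multiset.cons_erase h.2]
  · rintro ⟨k, t⟩ h
    simp
  · rintro ⟨s, k⟩ h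
    rfl

/-! ### Power sums over arbitrary coefficients -/

section Psum

open Classical in
/-- The power sum `∑ᵢ xᵢ ^ k` with coefficients in `R`. -/
def powerSum (R : Type*) [CommRing R] (k : ℕ) : MvPowerSeries ℕ R :=
  fun m => if ∃ i, m = Finsupp.single i k then 1 else 0

open Classical in
theorem coeff_powerSum (R : Type*) [CommRing R] (k : ℕ) (m : ℕ →₀ ℕ) :
    MvPowerSeries.coeff m (powerSum R k) = if ∃ i, m = Finsupp.single i k then 1 else 0 := rfl

theorem map_powerSum {R R' : Type*} [CommRing R] [CommRing R'] (f : R →+* R') (k : ℕ) :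
    MvPowerSeries.map f (powerSum R k) = powerSum R' k := by
  classical
  ext m
  rw [MvPowerSeries.coeff_map, coeff_powerSum, coeff_powerSum, apply_ite f, map_one, map_zero]

theorem coeff_powerSum_mul {R : Type*} [CommRing R] {k : ℕ} (hk : 0 < k) (f : MvPowerSeries ℕ R)
    (m : ℕ →₀ ℕ) : MvPowerSeries.coeff m (powerSum R k * f) =
      ∑ i ∈ m.support, if k ≤ m i then MvPowerSeries.coeff (m - Finsupp.single i k) f else 0 := by
  classical
  rw [MvPowerSeries.coeff_mul]
  simp only [coeff_powerSum, ite_mul, one_mul, zero_mul]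
  rw [← Finset.sum_filter, ← Finset.sum_filter]
  symm
  refine Finset.sum_bij (fun i _ => (Finsupp.single i k, m - Finsupp.single i k)) ?_ ?_ ?_ ?_
  · intro i hi
    rw [Finset.mem_filter] at hi ⊢
    rw [Finset.HasAntidiagonal.mem_antidiagonal]
    exact ⟨add_tsub_cancel_of_le (Finsupp.single_le_iff.2 hi.2), i, rfl⟩
  · intro i _ j _ h
    exact Finsupp.single_left_injective hk.ne' (Prod.ext_iff.1 h).1
  · rintro ⟨a, b⟩ h
    rw [Finset.mem_filter, Finset.HasAntidiagonal.mem_antidiagonal] at h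
    obtain ⟨rfl, i, hi⟩ := h
    simp only at hi
    subst hi
    refine ⟨i, ?_, ?_⟩
    · rw [Finset.mem_filter, Finsupp.mem_support_iff]
      simp only [Finsupp.add_apply, Finsupp.single_eq_same]
      omega
    · rw [add_tsub_cancel_left]
  · intro i _
    rfl

end Psum

theorem sum_range_ite_le {M : Type*} [AddCommMonoid M] {a n : ℕ} (h : a ≤ n) (f : ℕ → M) :
    (∑ k ∈ Finset.range (n + 1), if k ≤ a then f k else 0) = ∑ k ∈ Finset.range (a + 1), f k := by
  rw [← Finset.sum_filter]
  refine Finset.sum_congr ?_ fun _ _ => rfl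
  ext k
  simp only [Finset.mem_filter, Finset.mem_range]
  omega

/-- The support may lose i, but `he` makes the missing factor harmless. -/
theorem prod_sub_single {R : Type*} [CommRing R] (e : ℕ → R) (he : e 0 = 1) (m : ℕ →₀ ℕ) {i k : ℕ} (hi : i ∈ m.support) :
    ((m - Finsupp.single i k).prod fun _ n => e n) =
      e (m i - k) * ∏ j ∈ m.support.erase i, e (m j) := by
  rw [Finsupp.prod_of_support_subset (s := m.support) _ ?_ _ fun _ _ => he,
    ← Finset.mul_prod_erase _ _ hi]
  · congr 1
    · simp
    · refine Finset.prod_congr rfl fun j hj => ?_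
      simp [Finsupp.single_eq_of_ne (Finset.ne_of_mem_erase hj)]
  · intro j hj
    rw [Finsupp.mem_support_iff] at hj ⊢
    intro h
    simp [h] at hj

/-- If `e` and `p` are related by Newton's identities, then the monomial `x ^ m` has the coefficient
`∏ᵢ e (mᵢ)` in the Cauchy kernel `∑_λ (-1) ^ (|λ| - ℓ(λ)) z_λ⁻¹ p_λ p_λ(x)`. -/
theorem coeff_cycleSum_powerSum {e p : ℕ → R} (he : e 0 = 1) (hp : p 0 = 0)
    (newton : ∀ n : ℕ, (n : R) * e n =
      ∑ a ∈ Finset.HasAntidiagonal.antidiagonal n, (-1) ^ (a.1 + 1) * p a.1 * e a.2)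
    (m : ℕ →₀ ℕ) :
    MvPowerSeries.coeff m (cycleSum
      (fun k => MvPowerSeries.C ((-1) ^ (k + 1) * p k) * powerSum R k) m.degree) =
      m.prod fun _ n => e n := by
  induction hn : m.degree using Nat.strong_induction_on generalizing m with
  | _ n ih =>
  rcases Nat.eq_zero_or_pos n with rfl | hpos
  · rw [Finsupp.degree_eq_zero_iff] at hn
    rw [cycleSum_zero, hn, MvPowerSeries.coeff_zero_one, Finsupp.prod_zero_index]
  have hunit : IsUnit (n : R) := by
    have h := (IsUnit.mk0 (n : ℚ) (by exact_mod_cast hpos.ne')).map (algebraMap ℚ R)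
    rwa [map_natCast] at h
  refine hunit.mul_left_cancel ?_
  set A : ℕ → MvPowerSeries ℕ R :=
    fun k => MvPowerSeries.C ((-1) ^ (k + 1) * p k) * powerSum R k with hA
  have h1 : (n : R) * MvPowerSeries.coeff m (cycleSum A n) =
      MvPowerSeries.coeff m ((n : MvPowerSeries ℕ R) * cycleSum A n) := by
    rw [← map_natCast (MvPowerSeries.C (σ := ℕ) (R := R)), MvPowerSeries.coeff_C_mul]
  rw [h1, natCast_mul_cycleSum A (by simp [hA, hp]), map_sum]
  -- Multiplication by p_k(x) removes x_i^k from the monomial for some i, and the induction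
  -- hypothesis evaluates the rest.
  have h2 : ∀ k ∈ Finset.range (n + 1), MvPowerSeries.coeff m (A k * cycleSum A (n - k)) =
      ∑ i ∈ m.support, if k ≤ m i then
        (-1) ^ (k + 1) * p k * e (m i - k) * ∏ j ∈ m.support.erase i, e (m j) else 0 := by
    intro k hk
    rcases Nat.eq_zero_or_pos k with rfl | hk0
    · simp [hA, hp]
    rw [hA, mul_assoc, MvPowerSeries.coeff_C_mul, coeff_powerSum_mul hk0, Finset.mul_sum]
    refine Finset.sum_congr rfl fun i hi => ?_
    rw [mul_ite, mul_zero]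
    refine if_ctx_congr Iff.rfl (fun hki => ?_) fun _ => rfl
    have hdeg : (m - Finsupp.single i k).degree = n - k := by
      have h := congrArg Finsupp.degree (tsub_add_cancel_of_le (Finsupp.single_le_iff.2 hki))
      rw [map_add, Finsupp.degree_single, hn] at h
      omega
    rw [ih (n - k) (by omega) _ hdeg, prod_sub_single e he m hi, mul_assoc _ (e _)]
  rw [Finset.sum_congr rfl h2, Finset.sum_comm]
  -- For fixed i the sum over k is Newton's identity for m i. Summing the factors m i over i then
  -- gives n.
  have h3 : ∀ i ∈ m.support, (∑ k ∈ Finset.range (n + 1), if k ≤ m i then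
      (-1) ^ (k + 1) * p k * e (m i - k) * ∏ j ∈ m.support.erase i, e (m j) else 0) =
      (m i : R) * m.prod fun _ n => e n := by
    intro i hi
    have hmi : m i ≤ n := hn ▸ Finsupp.le_degree i m
    rw [sum_range_ite_le hmi, ← Finset.sum_mul, Finsupp.prod, ← Finset.mul_prod_erase _ _ hi,
      ← mul_assoc, newton, Finset.Nat.sum_antidiagonal_eq_sum_range_succ_mk]
  rw [Finset.sum_congr rfl h3, ← Finset.sum_mul, ← hn, Finsupp.degree_apply, Nat.cast_sum]

end

end Kromatic

namespace Kromatic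

noncomputable section

/-! ### The power sum expansion of the Kromatic function -/

theorem Ptn.rows_eq_ofFn (lam : Ptn) : lam.rows = List.ofFn lam.row := (List.ofFn_get lam.rows).symm

theorem Ptn.coe_rows (lam : Ptn) : (lam.rows : Multiset ℕ) = lam.2.parts := Multiset.sort_eq _ _

theorem Ptn.card_parts (lam : Ptn) : Multiset.card lam.2.parts = lam.length := by
  rw [← lam.coe_rows, Multiset.coe_card, Ptn.length]

theorem Ptn.prod_row {M : Type*} [CommMonoid M] (lam : Ptn) (f : ℕ → M) :
    ∏ i, f (lam.row i) = (lam.2.parts.map f).prod := by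
  rw [← lam.map_row, Multiset.map_map]
  rfl

theorem finsum_ptn {M : Type*} [AddCommMonoid M] (f : Ptn → M) (n : ℕ)
    (h : ∀ lam, f lam ≠ 0 → lam.1 = n) : ∑ᶠ lam, f lam = ∑ p : n.Partition, f ⟨n, p⟩ := by
  classical
  rw [finsum_eq_sum_of_support_subset f
    (s := Finset.univ.map ⟨Sigma.mk n, sigma_mk_injective⟩) ?_, Finset.sum_map]
  · rfl
  · rintro ⟨k, p⟩ hp
    obtain rfl : k = n := h _ hp
    simp

theorem finite_ptn_le (n : ℕ) : {lam : Ptn | lam.1 ≤ n}.Finite := by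
  have : {lam : Ptn | lam.1 ≤ n} = ⋃ k ∈ Set.Iic n, Set.range (Sigma.mk k) := by
    ext ⟨k, p⟩
    simp
  rw [this]
  exact (Set.finite_Iic n).biUnion fun k _ => Set.finite_range _

theorem psumPtn_eq (lam : Ptn) :
    psumPtn lam = (lam.2.parts.map (powerSum (Polynomial ℚ))).prod :=
  lam.prod_row psum

theorem degree_eq_of_coeff_psumPtn_ne_zero {lam : Ptn} {m : ℕ →₀ ℕ}
    (h : MvPowerSeries.coeff m (psumPtn lam) ≠ 0) : lam.1 = m.degree := by
  obtain ⟨f, rfl⟩ := (coeff_psumPtn_ne_zero_iff lam m).1 h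
  rw [map_sum, ← lam.sum_row]
  simp

theorem formalSummable_psumPtn (c : Ptn → Polynomial ℚ) :
    FormalSummable fun lam => c lam • psumPtn lam := by
  intro m
  refine (finite_ptn_le m.degree).subset fun lam hlam => ?_
  have : MvPowerSeries.coeff m (psumPtn lam) ≠ 0 := by
    intro h
    apply hlam
    rw [map_smul, h, smul_zero]
  exact (degree_eq_of_coeff_psumPtn_ne_zero this).le

theorem coeff_formalSum {ι : Type*} (f : ι → Series) (m : ℕ →₀ ℕ) :
    MvPowerSeries.coeff m (formalSum f) = ∑ᶠ i, MvPowerSeries.coeff m (f i) := rfl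

theorem omega_eq_formalSum {c : Ptn → Polynomial ℚ} {f : Series} (h : IsPsumExpansion c f) :
    omega f = formalSum fun lam : Ptn => ((-1) ^ (lam.1 - lam.length) * c lam) • psumPtn lam := by
  have hex : ∃ c, IsPsumExpansion c f := ⟨c, h⟩
  rw [omega, dif_pos hex, isPsumExpansion_unique hex.choose_spec h]

/-- These coefficients are rational scalars, so the ℚ-linear maps φ and `coverSum` pass through
them. -/
theorem coeff_prod_powerSum (R : Type*) [CommRing R] [Algebra ℚ R] (s : Multiset ℕ)
    (m : ℕ →₀ ℕ) : MvPowerSeries.coeff m (s.map (powerSum R)).prod =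
      algebraMap ℚ R (MvPowerSeries.coeff m (s.map (powerSum ℚ)).prod) := by
  rw [← MvPowerSeries.coeff_map, map_multiset_prod (MvPowerSeries.map (algebraMap ℚ R)),
    Multiset.map_map]
  congr 3
  funext k
  exact (map_powerSum _ k).symm

theorem prod_map_neg_one_pow {R : Type*} [CommRing R] (s : Multiset ℕ) :
    (s.map fun k => (-1 : R) ^ (k + 1)).prod = (-1) ^ (s.sum + Multiset.card s) := by
  induction s using Multiset.induction_on with
  | empty => simp
  | cons k s ih =>
    rw [Multiset.map_cons, Multiset.prod_cons, ih, Multiset.sum_cons, Multiset.card_cons, ← pow_add]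
    congr 1
    ring

theorem coeff_prod_C_mul_powerSum {R : Type*} [CommRing R] [Algebra ℚ R] (p : ℕ → R)
    (s : Multiset ℕ) (m : ℕ →₀ ℕ) :
    MvPowerSeries.coeff m
        (s.map fun k => MvPowerSeries.C ((-1) ^ (k + 1) * p k) * powerSum R k).prod =
      ((-1) ^ (s.sum + Multiset.card s) *
        MvPowerSeries.coeff m (s.map (powerSum ℚ)).prod : ℚ) • (s.map p).prod := by
  have h : (s.map fun k => MvPowerSeries.C (σ := ℕ) ((-1) ^ (k + 1) * p k)).prod =
      MvPowerSeries.C ((-1) ^ (s.sum + Multiset.card s) * (s.map p).prod) := by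
    rw [← prod_map_neg_one_pow, ← Multiset.prod_map_mul, map_multiset_prod, Multiset.map_map]
    rfl
  rw [Multiset.prod_map_mul, h, MvPowerSeries.coeff_C_mul, coeff_prod_powerSum, Algebra.smul_def,
    map_mul, map_pow, map_neg, map_one]
  ring

section Pyramids

variable {V : Type*} {G : SimpleGraph V}

theorem Heap.uses_list_prod (P : List (Heap G)) (v : V) :
    P.prod.Uses v ↔ ∃ H ∈ P, H.Uses v := by
  induction P with
  | nil =>
    rw [Heap.uses_iff]
    simp
  | cons H P ih =>
    rw [List.prod_cons, Heap.uses_iff, map_mul, toAdd_mul, Multiset.mem_add, ← Heap.uses_iff,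
      ← Heap.uses_iff, ih]
    simp

variable [LinearOrder V] [Fintype V]

/-- Expanding the product picks one pyramid of size λ_i for each i; `coverSum` records the ascents
of the composition and drops the lists that miss a vertex. -/
theorem coverSum_prod_pyramidOp (G : SimpleGraph V) (lam : Ptn) :
    coverSum (lam.rows.map (pyramidOp G)).prod = pyramidSum G lam := by
  classical
  have h1 : (lam.rows.map (pyramidOp G)).prod =
      ∑ g ∈ Fintype.piFinset fun i => {H ∈ heapsOfSize G (lam.row i) | H.IsPyramid},
        Heap.op (List.ofFn g).prod := by
    have := (MultilinearMap.mkPiAlgebraFin ℚ lam.length (TorusEnd V)).map_sum_finset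
      (fun _ H => Heap.op (G := G) H)
      (fun i => {H ∈ heapsOfSize G (lam.row i) | H.IsPyramid})
    simp only [MultilinearMap.mkPiAlgebraFin_apply] at this
    rw [lam.rows_eq_ofFn, List.map_ofFn]
    refine this.trans (Finset.sum_congr rfl fun g _ => ?_)
    rw [map_list_prod, List.map_ofFn]
    rfl
  rw [h1, map_sum, Finset.sum_congr rfl fun g _ => coverSum_op _, ← Finset.sum_filter, pyramidSum,
    finsum_mem_eq_finite_toFinset_sum _ (finite_pyramidLists G lam)]
  have hmem : ∀ g : Fin lam.length → Heap G,
      g ∈ ((Fintype.piFinset fun i => {H ∈ heapsOfSize G (lam.row i) | H.IsPyramid}).filter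
        fun g => ∀ v, (List.ofFn g).prod.Uses v) ↔ List.ofFn g ∈ pyramidLists G lam := by
    intro g
    have hsz : (List.ofFn g).map Heap.size = lam.rows ↔ ∀ i, (g i).size = lam.row i := by
      rw [lam.rows_eq_ofFn, List.map_ofFn, List.ofFn_inj, funext_iff]
      rfl
    simp only [pyramidLists, Set.mem_ofPred_eq, hsz, Finset.mem_filter, Fintype.mem_piFinset,
      mem_heapsOfSize, Heap.uses_list_prod, List.forall_mem_ofFn_iff, forall_and]
    tauto
  refine Finset.sum_bij (fun g _ => List.ofFn g) ?_ ?_ ?_ ?_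
  · intro g hg
    rw [Set.Finite.mem_toFinset]
    exact (hmem g).1 hg
  · exact fun g _ g' _ h => List.ofFn_injective h
  · intro P hP
    rw [Set.Finite.mem_toFinset] at hP
    have hlen : lam.length = P.length := by
      rw [Ptn.length, ← hP.2.1, List.length_map]
    have hof : List.ofFn (fun i : Fin lam.length => P.get (i.cast hlen)) = P := by
      rw [← List.ofFn_congr hlen.symm P.get, List.ofFn_get]
    exact ⟨_, (hmem _).2 (hof.symm ▸ hP), hof⟩
  · exact fun _ _ => rfl

theorem coeff_kromatic_eq_coverSum {C : Type*} [CommRing C] [Algebra ℚ C] (φ : C →ₐ[ℚ] TorusEnd V)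
    {e : ℕ → C} (he0 : e 0 = 1) (he : ∀ k, φ (e k) = stableSum G k) (m : ℕ →₀ ℕ) :
    MvPowerSeries.coeff m (kromatic G) = coverSum (φ (m.prod fun _ n => e n)) := by
  obtain ⟨N, hN⟩ : ∃ N, m.support ⊆ Finset.range N := m.support.exists_nat_subset_range
  rw [coeff_kromatic G hN, Finsupp.prod_of_support_subset m hN _ fun _ _ => he0,
    Finset.prod_range, ← List.prod_ofFn, map_list_prod φ, List.map_ofFn]
  congr 3
  funext i
  exact (he _).symm

/-- In the commutative model the product ∏ e_{m_i} does not see the order of the exponents. -/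
theorem isSymmetricSeries_kromatic (hG : IsIntervalLabelling G) :
    IsSymmetricSeries (kromatic G) := by
  obtain ⟨C, _, _, φ, e, p, he, -, he0, -, -⟩ := exists_commRing_model hG
  intro σ m
  rw [coeff_kromatic_eq_coverSum φ he0 he, coeff_kromatic_eq_coverSum φ he0 he,
    Finsupp.prod_mapDomain_index_inj σ.injective]

/-- This is the Cauchy identity in the commutative model, seen through `coverSum` ∘ φ, which turns
p_λ into the pyramid sum. -/
theorem isPsumExpansion_kromatic (hG : IsIntervalLabelling G) :
    IsPsumExpansion (fun lam => (-1) ^ (lam.1 - lam.length) *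
      (Polynomial.C (1 / (lam.z : ℚ)) * pyramidSum G lam)) (kromatic G) := by
  obtain ⟨C, _, _, φ, e, p, he, hp, he0, hp0, newton⟩ := exists_commRing_model hG
  refine ⟨formalSummable_psumPtn _, MvPowerSeries.ext fun m => ?_⟩
  rw [coeff_formalSum, finsum_ptn _ m.degree, coeff_kromatic_eq_coverSum φ he0 he,
    ← coeff_cycleSum_powerSum he0 hp0 newton, cycleSum, partitionsOf,
    Finset.sum_image fun p _ q _ h => Nat.Partition.ext h, map_sum, map_sum, map_sum]
  · refine Finset.sum_congr rfl fun s _ => ?_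
    set lam : Ptn := ⟨m.degree, s⟩ with hlam
    have hpyr : coverSum (φ (s.parts.map p).prod) = pyramidSum G lam := by
      rw [← coverSum_prod_pyramidOp, ← lam.coe_rows, Multiset.map_coe, Multiset.prod_coe,
        map_list_prod φ, List.map_map]
      congr 3
      funext k
      exact hp k
    -- |λ| + ℓ(λ) and |λ| - ℓ(λ) have the same parity; ℓ(λ) ≤ |λ| keeps the natural subtraction
    -- exact.
    have hsign : ((-1) ^ (s.parts.sum + Multiset.card s.parts) : ℚ) =
        (-1) ^ (lam.1 - lam.length) := by
      have h := lam.length_le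
      rw [s.parts_sum, lam.card_parts, show m.degree + lam.length =
        lam.1 - lam.length + 2 * lam.length by change lam.1 + _ = _; omega, pow_add, pow_mul,
        neg_one_sq, one_pow, mul_one]
    have hsmul : ∀ (c : ℚ) (f : MvPowerSeries ℕ C),
        MvPowerSeries.coeff m (c • f) = c • MvPowerSeries.coeff m f := fun _ _ => rfl
    rw [hsmul, coeff_prod_C_mul_powerSum, map_smul, map_smul, map_smul, map_smul, hpyr, hsign,
      map_smul, psumPtn_eq, coeff_prod_powerSum (Polynomial ℚ)]
    change (zee s.parts : ℚ)⁻¹ • _ = ((-1) ^ (lam.1 - lam.length) *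
      (Polynomial.C (1 / (zee s.parts : ℚ)) * pyramidSum G lam)) • _
    rw [smul_eq_mul, Polynomial.smul_eq_C_mul, Polynomial.smul_eq_C_mul, one_div, map_mul, map_pow,
      map_neg, map_one, Polynomial.algebraMap_eq]
    ring
  · intro lam h
    refine degree_eq_of_coeff_psumPtn_ne_zero fun h0 => h ?_
    rw [map_smul, h0, smul_zero]

theorem formalHasSum_omega_kromatic (hG : IsIntervalLabelling G) :
    FormalHasSum (fun lam => (Polynomial.C (1 / (lam.z : ℚ)) * pyramidSum G lam) • psumPtn lam)
      (omega (kromatic G)) := by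
  refine ⟨formalSummable_psumPtn _, ?_⟩
  rw [omega_eq_formalSum (isPsumExpansion_kromatic hG)]
  congr 1
  funext lam
  rw [← mul_assoc, ← pow_add, ← two_mul, pow_mul, neg_one_sq, one_pow, one_mul]

end Pyramids

end

end Kromatic

namespace Kromatic

noncomputable section

/-! ### The Euler operator and logarithms -/

/-- The Euler operator `∑ᵢ xᵢ ∂/∂xᵢ`, which multiplies a monomial by its degree. -/
def euler : Series →ₗ[Polynomial ℚ] Series where
  toFun f m := (m.degree : Polynomial ℚ) * MvPowerSeries.coeff m f
  map_add' f g := by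
    ext1 m
    exact mul_add _ _ _
  map_smul' c f := by
    ext1 m
    exact mul_left_comm _ _ _

theorem coeff_euler (f : Series) (m : ℕ →₀ ℕ) :
    MvPowerSeries.coeff m (euler f) = (m.degree : Polynomial ℚ) * MvPowerSeries.coeff m f := rfl

theorem euler_mul (f g : Series) : euler (f * g) = euler f * g + f * euler g := by
  classical
  ext1 m
  rw [coeff_euler, map_add, MvPowerSeries.coeff_mul, MvPowerSeries.coeff_mul,
    MvPowerSeries.coeff_mul, Finset.mul_sum, ← Finset.sum_add_distrib]
  refine Finset.sum_congr rfl fun a ha => ?_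
  rw [Finset.HasAntidiagonal.mem_antidiagonal] at ha
  rw [coeff_euler, coeff_euler, ← ha, map_add]
  push_cast
  ring

theorem euler_pow (f : Series) (n : ℕ) : euler (f ^ (n + 1)) = (n + 1) * f ^ n * euler f := by
  induction n with
  | zero => simp
  | succ n ih =>
    rw [pow_succ, euler_mul, ih]
    push_cast
    ring

/-- Agreement of two power series up to degree `N`. -/
def AgreeUpTo (N : ℕ) (f g : Series) : Prop :=
  ∀ m : ℕ →₀ ℕ, m.degree ≤ N → MvPowerSeries.coeff m f = MvPowerSeries.coeff m g

namespace AgreeUpTo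

variable {N : ℕ} {f f' g g' : Series}

theorem refl (f : Series) : AgreeUpTo N f f := fun _ _ => rfl

theorem trans {k : Series} (h : AgreeUpTo N f g) (h' : AgreeUpTo N g k) : AgreeUpTo N f k :=
  fun m hm => (h m hm).trans (h' m hm)

theorem mul (h : AgreeUpTo N f g) (h' : AgreeUpTo N f' g') : AgreeUpTo N (f * f') (g * g') := by
  classical
  intro m hm
  rw [MvPowerSeries.coeff_mul, MvPowerSeries.coeff_mul]
  refine Finset.sum_congr rfl fun a ha => ?_
  rw [Finset.HasAntidiagonal.mem_antidiagonal] at ha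
  have hd : a.1.degree + a.2.degree = m.degree := by rw [← map_add, ha]
  rw [h _ (by omega), h' _ (by omega)]

theorem prod {ι : Type*} (s : Finset ι) {f g : ι → Series}
    (h : ∀ i ∈ s, AgreeUpTo N (f i) (g i)) : AgreeUpTo N (∏ i ∈ s, f i) (∏ i ∈ s, g i) := by
  classical
  induction s using Finset.induction_on with
  | empty => exact refl _
  | insert a s ha ih =>
    rw [Finset.prod_insert ha, Finset.prod_insert ha]
    exact (h a (Finset.mem_insert_self a s)).mul
      (ih fun i hi => h i (Finset.mem_insert_of_mem hi))

theorem euler (h : AgreeUpTo N f g) : AgreeUpTo N (Kromatic.euler f) (Kromatic.euler g) := by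
  intro m hm
  rw [coeff_euler, coeff_euler, h m hm]

end AgreeUpTo

theorem eq_of_agreeUpTo {f g : Series} (h : ∀ N, AgreeUpTo N f g) : f = g :=
  MvPowerSeries.ext fun m => h m.degree m le_rfl

theorem coeff_pow_eq_zero_of_degree_lt {f : Series} (h0 : MvPowerSeries.coeff 0 f = 0) {j : ℕ}
    {m : ℕ →₀ ℕ} (h : m.degree < j) : MvPowerSeries.coeff m (f ^ j) = 0 := by
  classical
  induction j generalizing m with
  | zero => exact absurd h (Nat.not_lt_zero _)
  | succ j ih =>
    rw [pow_succ, MvPowerSeries.coeff_mul]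
    refine Finset.sum_eq_zero fun a ha => ?_
    rw [Finset.HasAntidiagonal.mem_antidiagonal] at ha
    have hd : a.1.degree + a.2.degree = m.degree := by rw [← map_add, ha]
    by_cases h2 : a.2 = 0
    · rw [h2, h0, mul_zero]
    · have : a.2.degree ≠ 0 := fun hh => h2 ((Finsupp.degree_eq_zero_iff _).1 hh)
      rw [ih (by omega), zero_mul]

theorem hasSubst_of_coeff_zero {f : Series} (h0 : MvPowerSeries.coeff 0 f = 0) :
    PowerSeries.HasSubst f := by
  apply PowerSeries.HasSubst.of_constantCoeff_zero
  rwa [← MvPowerSeries.coeff_zero_eq_constantCoeff_apply]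

/-- The partial sums of the logarithm series. -/
def logPartial (f : Series) (N : ℕ) : Series :=
  ∑ j ∈ Finset.range N, Polynomial.C ((-1 : ℚ) ^ j / (j + 1)) • f ^ (j + 1)

theorem agreeUpTo_logOneAdd {f : Series} (h0 : MvPowerSeries.coeff 0 f = 0) (N : ℕ) :
    AgreeUpTo N (logOneAdd f) (logPartial f N) := by
  intro m hm
  rw [logOneAdd, PowerSeries.coeff_subst (hasSubst_of_coeff_zero h0), logPartial, map_sum,
    finsum_eq_sum_of_support_subset (s := Finset.range (N + 1)), Finset.sum_range_succ']
  · rw [PowerSeries.coeff_log, if_pos rfl, zero_smul, add_zero]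
    refine Finset.sum_congr rfl fun j _ => ?_
    rw [PowerSeries.coeff_log, if_neg j.succ_ne_zero, map_smul]
    congr 1
    rw [pow_add, pow_add, pow_one, mul_assoc, neg_one_mul, neg_neg, mul_one, Nat.cast_add,
      Nat.cast_one]
    rfl
  · intro j hj
    by_contra hcon
    apply hj
    simp only [Finset.coe_range, Set.mem_Iio, not_lt] at hcon
    simp only
    rw [coeff_pow_eq_zero_of_degree_lt h0 (by omega), smul_zero]

theorem coeff_zero_logOneAdd {f : Series} (h0 : MvPowerSeries.coeff 0 f = 0) :
    MvPowerSeries.coeff 0 (logOneAdd f) = 0 := by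
  rw [agreeUpTo_logOneAdd h0 0 0 (by simp)]
  simp [logPartial]

/-- Each new term of the partial sum has Euler derivative (-f)^N times that of f, so multiplication
by 1 + f telescopes a geometric sum. -/
theorem one_add_mul_euler_logPartial (f : Series) (N : ℕ) :
    (1 + f) * euler (logPartial f N) = euler f - (-f) ^ N * euler f := by
  induction N with
  | zero => simp [logPartial]
  | succ N ih =>
    rw [logPartial, Finset.sum_range_succ, ← logPartial, map_add, mul_add, ih, map_smul, euler_pow]
    have h : Polynomial.C ((-1 : ℚ) ^ N / (N + 1)) • (((N : Series) + 1) * f ^ N * euler f) =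
        (-f) ^ N * euler f := by
      have hN : ((N : Series) + 1) = Polynomial.C ((N : ℚ) + 1) • 1 := by
        rw [MvPowerSeries.smul_eq_C_mul, mul_one, map_add, map_add, map_natCast, map_natCast,
          map_one, map_one]
      rw [hN, smul_mul_assoc, smul_mul_assoc, one_mul, smul_smul, ← map_mul,
        div_mul_cancel₀ _ (by positivity), map_pow, map_neg, map_one, neg_pow f,
        MvPowerSeries.smul_eq_C_mul, map_pow, map_neg, map_one, mul_assoc]
    rw [h]
    ring

theorem one_add_mul_euler_logOneAdd {f : Series} (h0 : MvPowerSeries.coeff 0 f = 0) :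
    (1 + f) * euler (logOneAdd f) = euler f := by
  refine eq_of_agreeUpTo fun N => ?_
  -- One term beyond the degree bound makes the remainder (-f)^(N+1) vanish up to degree N.
  have h1 : AgreeUpTo N ((1 + f) * euler (logOneAdd f)) ((1 + f) * euler (logPartial f (N + 1))) := by
    refine (AgreeUpTo.refl _).mul (AgreeUpTo.euler fun m hm => ?_)
    exact agreeUpTo_logOneAdd h0 (N + 1) m (by omega)
  rw [one_add_mul_euler_logPartial] at h1
  have h2 : AgreeUpTo N ((-f) ^ (N + 1)) 0 := fun m hm =>
    coeff_pow_eq_zero_of_degree_lt (by rw [map_neg, h0, neg_zero]) (by omega)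
  intro m hm
  rw [h1 m hm, map_sub, h2.mul (AgreeUpTo.refl (euler f)) m hm, zero_mul, map_zero, sub_zero]

/-! ### The logarithm of 1 + p̄'_k and Möbius inversion -/

theorem coeff_zero_pbar (k : ℕ) : MvPowerSeries.coeff 0 (pbar k) = 0 := by
  rw [coeff_pbar]
  simp

open Classical in
theorem coeff_one_add_pbar (k : ℕ) (m : ℕ →₀ ℕ) :
    MvPowerSeries.coeff m (1 + pbar k) = if ∀ i, k ∣ m i then 1 else 0 := by
  rw [map_add, MvPowerSeries.coeff_one, coeff_pbar]
  by_cases h : m = 0 <;> simp [h]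

theorem coeff_psum_single {k i : ℕ} (j : ℕ) (hk : 0 < k) :
    MvPowerSeries.coeff (Finsupp.single i k) (psum j) = if j = k then 1 else 0 := by
  classical
  change (if ∃ i', Finsupp.single i k = Finsupp.single i' j then (1 : Polynomial ℚ) else 0) = _
  refine if_congr ⟨?_, ?_⟩ rfl rfl
  · rintro ⟨i', h⟩
    have := congrArg Finsupp.degree h
    simpa using this.symm
  · rintro rfl
    exact ⟨i, rfl⟩

theorem coeff_psum_eq_zero {m : ℕ →₀ ℕ} {j : ℕ} (h : ∀ i, m ≠ Finsupp.single i j) :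
    MvPowerSeries.coeff m (psum j) = 0 :=
  if_neg fun ⟨i, hi⟩ => h i hi

theorem euler_psum (j : ℕ) : euler (psum j) = (j : Polynomial ℚ) • psum j := by
  ext1 m
  rw [coeff_euler, map_smul, smul_eq_mul]
  by_cases h : ∃ i, m = Finsupp.single i j
  · obtain ⟨i, rfl⟩ := h
    rw [Finsupp.degree_single]
  · rw [coeff_psum_eq_zero (not_exists.1 h), mul_zero, mul_zero]

/-- The partial sums of the series `∑_{n ≥ 1} p_{nk} / n`. -/
def psumLogPartial (k N : ℕ) : Series :=
  ∑ n ∈ Finset.range N, Polynomial.C (1 / ((n : ℚ) + 1)) • psum ((n + 1) * k)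

theorem euler_psumLogPartial (k N : ℕ) :
    euler (psumLogPartial k N) =
      ∑ n ∈ Finset.range N, (k : Polynomial ℚ) • psum ((n + 1) * k) := by
  rw [psumLogPartial, map_sum]
  refine Finset.sum_congr rfl fun n _ => ?_
  rw [map_smul, euler_psum, smul_smul]
  congr 1
  rw [← map_natCast Polynomial.C, ← map_mul, ← map_natCast Polynomial.C]
  congr 1
  have : (n : ℚ) + 1 ≠ 0 := by positivity
  push_cast
  field_simp

theorem sum_range_ite_mul_le {k : ℕ} (hk : 0 < k) {a N : ℕ} (hkN : a ≤ N) :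
    (∑ n ∈ Finset.range N, if (n + 1) * k ≤ a then 1 else 0) = a / k := by
  rw [← Finset.card_filter]
  have : (Finset.range N).filter (fun n => (n + 1) * k ≤ a) = Finset.range (a / k) := by
    ext n
    rw [Finset.mem_filter, Finset.mem_range, Finset.mem_range, ← Nat.le_div_iff_mul_le hk]
    have := Nat.div_le_self a k
    omega
  rw [this, Finset.card_range]

/-- Removing x_i^(nk) preserves divisibility of all exponents by k. There are ⌊m_i/k⌋ choices of n
for each i, each of weight k, so for divisible exponents the total is the degree of the monomial. -/
theorem agreeUpTo_one_add_pbar_mul {k : ℕ} (hk : 0 < k) (N : ℕ) :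
    AgreeUpTo N ((1 + pbar k) * euler (psumLogPartial k N)) (euler (pbar k)) := by
  classical
  intro m hm
  have h1 : ∀ i ∈ m.support, ∀ n, (n + 1) * k ≤ m i →
      MvPowerSeries.coeff (m - Finsupp.single i ((n + 1) * k)) (1 + pbar k) =
        MvPowerSeries.coeff m (1 + pbar k) := by
    intro i hi n hn
    rw [coeff_one_add_pbar, coeff_one_add_pbar]
    refine if_congr (forall_congr' fun j => ?_) rfl rfl
    by_cases hij : j = i
    · subst hij
      simp only [Finsupp.coe_tsub, Pi.sub_apply, Finsupp.single_eq_same]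
      exact Nat.dvd_sub_iff_left hn (Nat.dvd_mul_left _ _)
    · simp [Finsupp.single_eq_of_ne hij]
  have h2 : MvPowerSeries.coeff m ((1 + pbar k) * euler (psumLogPartial k N)) =
      ((∑ i ∈ m.support, k * (m i / k) : ℕ) : Polynomial ℚ) *
        MvPowerSeries.coeff m (1 + pbar k) := by
    rw [euler_psumLogPartial, mul_comm, Finset.sum_mul, map_sum]
    have h3 : ∀ n ∈ Finset.range N,
        MvPowerSeries.coeff m ((k : Polynomial ℚ) • psum ((n + 1) * k) * (1 + pbar k)) =
          ∑ i ∈ m.support, (k : Polynomial ℚ) * (if (n + 1) * k ≤ m i then 1 else 0) *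
            MvPowerSeries.coeff m (1 + pbar k) := by
      intro n _
      rw [smul_mul_assoc, map_smul, smul_eq_mul]
      change _ * MvPowerSeries.coeff m (powerSum (Polynomial ℚ) ((n + 1) * k) * _) = _
      rw [coeff_powerSum_mul (by positivity), Finset.mul_sum]
      refine Finset.sum_congr rfl fun i hi => ?_
      split_ifs with hle
      · rw [h1 i hi n hle, mul_one]
      · rw [mul_zero, zero_mul]
    rw [Finset.sum_congr rfl h3, Finset.sum_comm, Nat.cast_sum, Finset.sum_mul]
    refine Finset.sum_congr rfl fun i _ => ?_
    rw [← Finset.sum_mul, ← Finset.mul_sum,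
      ← sum_range_ite_mul_le hk ((Finsupp.le_degree i m).trans hm)]
    push_cast
    rfl
  rw [h2, coeff_euler, coeff_one_add_pbar, coeff_pbar]
  by_cases hdvd : ∀ i, k ∣ m i
  · rw [Finset.sum_congr rfl fun i _ => Nat.mul_div_cancel' (hdvd i), ← Finsupp.degree_apply]
    by_cases h0 : m = 0
    · simp [h0]
    · simp [h0, hdvd]
  · simp [hdvd]

/-- After cancelling the unit 1 + p̄'_k, both sides have the same Euler derivative up to degree N;
this determines everything but the constant terms, which are both 0. -/
theorem agreeUpTo_logOneAdd_pbar {k : ℕ} (hk : 0 < k) (N : ℕ) :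
    AgreeUpTo N (logOneAdd (pbar k)) (psumLogPartial k N) := by
  have hunit : IsUnit (1 + pbar k) := by
    rw [MvPowerSeries.isUnit_iff_constantCoeff, map_add, map_one,
      ← MvPowerSeries.coeff_zero_eq_constantCoeff_apply (pbar k), coeff_zero_pbar, add_zero]
    exact isUnit_one
  obtain ⟨g, hg⟩ := hunit.exists_left_inv
  have h := agreeUpTo_one_add_pbar_mul hk N
  rw [← one_add_mul_euler_logOneAdd (coeff_zero_pbar k)] at h
  have h' := (AgreeUpTo.refl g).mul h
  rw [← mul_assoc, ← mul_assoc, hg, one_mul, one_mul] at h'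
  intro m hm
  by_cases h0 : m = 0
  · subst h0
    rw [coeff_zero_logOneAdd (coeff_zero_pbar k), psumLogPartial, map_sum]
    refine (Finset.sum_eq_zero fun n _ => ?_).symm
    rw [map_smul, coeff_psum_eq_zero, smul_zero]
    intro i hi
    have := congrArg Finsupp.degree hi
    rw [map_zero, Finsupp.degree_single] at this
    have : 0 < (n + 1) * k := by positivity
    omega
  · have h2 := h' m hm
    rw [coeff_euler, coeff_euler] at h2
    refine (mul_left_cancel₀ ?_ h2).symm
    rw [Nat.cast_ne_zero]
    exact fun hh => h0 ((Finsupp.degree_eq_zero_iff m).1 hh)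

theorem coeff_logOneAdd_pbar_single {k i j : ℕ} (hk : 0 < k) (hj : 0 < j) :
    MvPowerSeries.coeff (Finsupp.single i j) (logOneAdd (pbar k)) =
      Polynomial.C (if k ∣ j then (k : ℚ) / j else 0) := by
  rw [agreeUpTo_logOneAdd_pbar hk j _ (by simp), psumLogPartial, map_sum]
  simp only [map_smul, coeff_psum_single _ hj, smul_eq_mul, mul_ite, mul_one, mul_zero]
  split_ifs with h
  · obtain ⟨c, rfl⟩ := h
    have hc : 0 < c := Nat.pos_of_mul_pos_left hj
    rw [Finset.sum_eq_single (c - 1)]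
    · rw [if_pos (by rw [Nat.sub_add_cancel hc, mul_comm])]
      congr 1
      have : ((c - 1 : ℕ) : ℚ) + 1 = c := by
        rw [← Nat.cast_succ, Nat.succ_eq_add_one, Nat.sub_add_cancel hc]
      rw [this]
      push_cast
      have : (k : ℚ) ≠ 0 := by exact_mod_cast hk.ne'
      field_simp
    · intro n _ hn
      refine if_neg fun hh => hn ?_
      have : n + 1 = c := Nat.eq_of_mul_eq_mul_right hk (by rw [hh, mul_comm])
      omega
    · intro hh
      exact absurd (Finset.mem_range.2 (by nlinarith [Nat.sub_lt hc one_pos])) hh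
  · rw [map_zero]
    refine Finset.sum_eq_zero fun n _ => if_neg fun hh => h ?_
    exact hh ▸ Nat.dvd_mul_left _ _

theorem coeff_logOneAdd_pbar_eq_zero {k : ℕ} (hk : 0 < k) {m : ℕ →₀ ℕ}
    (hm : ∀ i j, 0 < j → m ≠ Finsupp.single i j) :
    MvPowerSeries.coeff m (logOneAdd (pbar k)) = 0 := by
  rw [agreeUpTo_logOneAdd_pbar hk m.degree m le_rfl, psumLogPartial, map_sum]
  refine Finset.sum_eq_zero fun n _ => ?_
  rw [map_smul, coeff_psum_eq_zero fun i => hm i _ (by positivity), smul_zero]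

theorem sum_moebius_divisors (n : ℕ) :
    ∑ d ∈ n.divisors, (ArithmeticFunction.moebius d : ℚ) = if n = 1 then 1 else 0 := by
  have h := congrArg (fun f => f n) ArithmeticFunction.moebius_mul_coe_zeta
  simp only [ArithmeticFunction.coe_mul_zeta_apply, ArithmeticFunction.one_apply] at h
  exact_mod_cast h

/-- Möbius inversion: `∑_d (μ(d) / d) ln (1 + p̄'_{dk})` is the power sum `p_k`. -/
theorem moebiusLog_eq_psum {k : ℕ} (hk : 0 < k) : moebiusLog k = psum k := by
  ext1 m
  rw [moebiusLog, coeff_formalSum]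
  by_cases hm : ∃ i j, 0 < j ∧ m = Finsupp.single i j
  · obtain ⟨i, j, hj, rfl⟩ := hm
    -- The factor 1/d cancels the d in the coefficient dk/j, leaving a plain Möbius sum over the
    -- divisors of j/k.
    have hterm : ∀ d : ℕ+, MvPowerSeries.coeff (Finsupp.single i j)
        (Polynomial.C ((ArithmeticFunction.moebius (d : ℕ) : ℚ) / (d : ℚ)) •
          logOneAdd (pbar (d * k))) =
        Polynomial.C (if (d : ℕ) * k ∣ j then
          (k : ℚ) / j * ArithmeticFunction.moebius (d : ℕ) else 0) := by
      intro d
      rw [map_smul, coeff_logOneAdd_pbar_single (Nat.mul_pos d.pos hk) hj, smul_eq_mul, ← map_mul]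
      congr 1
      split_ifs
      · have : ((d : ℕ) : ℚ) ≠ 0 := by exact_mod_cast d.pos.ne'
        push_cast
        field_simp
      · rw [mul_zero]
    simp only [hterm]
    rw [coeff_psum_single k hj]
    by_cases hkj : k ∣ j
    · obtain ⟨c, rfl⟩ := hkj
      have hc : 0 < c := Nat.pos_of_mul_pos_left hj
      have hdvd : ∀ d : ℕ, d * k ∣ k * c ↔ d ∣ c := fun d => by
        rw [mul_comm d k, Nat.mul_dvd_mul_iff_left hk]
      let ι : {d // d ∈ c.divisors} ↪ ℕ+ :=
        ⟨fun d => ⟨d.1, Nat.pos_of_mem_divisors d.2⟩, fun a b h =>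
          Subtype.ext (congrArg PNat.val h)⟩
      have hι : ∀ x, (ι x : ℕ) = x := fun _ => rfl
      rw [finsum_eq_sum_of_support_subset (s := c.divisors.attach.map ι), Finset.sum_map]
      · simp only [hι, hdvd]
        rw [Finset.sum_attach c.divisors (fun d => Polynomial.C (if d ∣ c then
          (k : ℚ) / (k * c : ℕ) * ArithmeticFunction.moebius d else 0)), ← map_sum,
          Finset.sum_congr rfl fun d hd => if_pos (Nat.dvd_of_mem_divisors hd), ← Finset.mul_sum,
          sum_moebius_divisors]
        have hk' : (k : ℚ) ≠ 0 := by exact_mod_cast hk.ne'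
        by_cases h1 : c = 1
        · subst h1
          simp [hk']
        · rw [if_neg h1, mul_zero, map_zero, if_neg]
          intro h
          exact h1 (Nat.eq_of_mul_eq_mul_left hk (by rw [← h, mul_one]))
      · intro d hd
        have : (d : ℕ) ∣ c := by
          by_contra hcon
          apply hd
          simp only
          rw [if_neg (fun h => hcon ((hdvd d).1 h)), map_zero]
        simp only [Finset.coe_map, Set.mem_image, Finset.mem_coe]
        exact ⟨⟨d, Nat.mem_divisors.2 ⟨this, hc.ne'⟩⟩, Finset.mem_attach _ _, rfl⟩
    · rw [finsum_eq_zero_of_forall_eq_zero, if_neg]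
      · rintro rfl
        exact hkj dvd_rfl
      · intro d
        rw [if_neg fun h => hkj ((Nat.dvd_mul_left k d).trans h), map_zero]
  · push Not at hm
    rw [coeff_psum_eq_zero fun i => hm i k hk, finsum_eq_zero_of_forall_eq_zero]
    intro d
    rw [map_smul, coeff_logOneAdd_pbar_eq_zero (Nat.mul_pos d.pos hk) hm, smul_zero]

end

end Kromatic

namespace Kromatic

noncomputable section

/-! ### Expansions in the K-theoretic power sums -/

theorem pbarPtn_eq (lam : Ptn) : pbarPtn lam = (lam.2.parts.map pbar).prod := lam.prod_row pbar

/-- The series `f` has no terms of degree less than `a`, and its terms of degree `a` are those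
of `g`. -/
def HasLeadingPart (a : ℕ) (f g : Series) : Prop :=
  AgreeUpTo a f g ∧ ∀ m : ℕ →₀ ℕ, m.degree < a → MvPowerSeries.coeff m f = 0

theorem HasLeadingPart.mul {a b : ℕ} {f f' g g' : Series} (h : HasLeadingPart a f g)
    (h' : HasLeadingPart b f' g') : HasLeadingPart (a + b) (f * f') (g * g') := by
  classical
  constructor
  · intro m hm
    rw [MvPowerSeries.coeff_mul, MvPowerSeries.coeff_mul]
    refine Finset.sum_congr rfl fun x hx => ?_
    rw [Finset.HasAntidiagonal.mem_antidiagonal] at hx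
    have hd : x.1.degree + x.2.degree = m.degree := by rw [← map_add, hx]
    rcases lt_or_ge x.1.degree a with h1 | h1
    · rw [← h.1 _ h1.le, h.2 _ h1, zero_mul, zero_mul]
    rcases lt_or_ge x.2.degree b with h2 | h2
    · rw [← h'.1 _ h2.le, h'.2 _ h2, mul_zero, mul_zero]
    rw [h.1 _ (by omega), h'.1 _ (by omega)]
  · intro m hm
    rw [MvPowerSeries.coeff_mul]
    refine Finset.sum_eq_zero fun x hx => ?_
    rw [Finset.HasAntidiagonal.mem_antidiagonal] at hx
    have hd : x.1.degree + x.2.degree = m.degree := by rw [← map_add, hx]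
    rcases lt_or_ge x.1.degree a with h1 | h1
    · rw [h.2 _ h1, zero_mul]
    · rw [h'.2 _ (by omega), mul_zero]

theorem le_degree_of_coeff_pbar_ne_zero {k : ℕ} {m : ℕ →₀ ℕ}
    (h : MvPowerSeries.coeff m (pbar k) ≠ 0) : ∃ i, k ≤ m i := by
  classical
  rw [coeff_pbar] at h
  obtain ⟨h0, hdvd⟩ := (ite_ne_right_iff.1 h).1
  obtain ⟨i, hi⟩ := Finsupp.ne_iff.1 h0
  exact ⟨i, Nat.le_of_dvd (Nat.pos_of_ne_zero hi) (hdvd i)⟩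

/-- A monomial of p̄'_k has some exponent at least k, so in degree at most k it can only be x_i^k.
-/
theorem hasLeadingPart_pbar {k : ℕ} (hk : 0 < k) : HasLeadingPart k (pbar k) (psum k) := by
  have hle : ∀ m : ℕ →₀ ℕ, MvPowerSeries.coeff m (pbar k) ≠ 0 → m.degree ≤ k →
      ∃ i, m = Finsupp.single i k := by
    intro m hm hdeg
    obtain ⟨i, hi⟩ := le_degree_of_coeff_pbar_ne_zero hm
    refine ⟨i, ?_⟩
    have h1 := tsub_add_cancel_of_le (Finsupp.single_le_iff.2 hi)
    have h2 := congrArg Finsupp.degree h1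
    rw [map_add, Finsupp.degree_single] at h2
    have h3 : m - Finsupp.single i k = 0 := (Finsupp.degree_eq_zero_iff _).1 (by omega)
    rw [← h1, h3, zero_add]
  constructor
  · intro m hm
    by_cases h : ∃ i, m = Finsupp.single i k
    · obtain ⟨i, rfl⟩ := h
      rw [coeff_psum_single k hk, if_pos rfl, coeff_pbar, if_pos]
      refine ⟨by simpa using hk.ne', fun j => ?_⟩
      rw [Finsupp.single_apply]
      split_ifs <;> simp
    · rw [coeff_psum_eq_zero (not_exists.1 h)]
      by_contra hne
      exact h (hle m hne hm)
  · intro m hm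
    by_contra hne
    obtain ⟨i, rfl⟩ := hle m hne hm.le
    simp at hm

theorem hasLeadingPart_prod_pbar {s : Multiset ℕ} (hs : ∀ k ∈ s, 0 < k) :
    HasLeadingPart s.sum (s.map pbar).prod (s.map psum).prod := by
  induction s using Multiset.induction_on with
  | empty => exact ⟨AgreeUpTo.refl _, fun m hm => absurd hm (Nat.not_lt_zero _)⟩
  | cons k s ih =>
    rw [Multiset.sum_cons, Multiset.map_cons, Multiset.map_cons, Multiset.prod_cons,
      Multiset.prod_cons]
    exact (hasLeadingPart_pbar (hs k (Multiset.mem_cons_self k s))).mul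
      (ih fun j hj => hs j (Multiset.mem_cons_of_mem hj))

theorem hasLeadingPart_pbarPtn (lam : Ptn) : HasLeadingPart lam.1 (pbarPtn lam) (psumPtn lam) := by
  have h := hasLeadingPart_prod_pbar (s := lam.2.parts) fun k hk => lam.2.parts_pos hk
  rw [lam.2.parts_sum] at h
  rwa [pbarPtn_eq, psumPtn_eq]

theorem le_degree_of_coeff_pbarPtn_ne_zero {lam : Ptn} {m : ℕ →₀ ℕ}
    (h : MvPowerSeries.coeff m (pbarPtn lam) ≠ 0) : lam.1 ≤ m.degree := by
  by_contra hlt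
  exact h ((hasLeadingPart_pbarPtn lam).2 m (not_le.1 hlt))

theorem formalSummable_pbarPtn (c : Ptn → Polynomial ℚ) :
    FormalSummable fun lam => c lam • pbarPtn lam := by
  intro m
  refine (finite_ptn_le m.degree).subset fun lam hlam => ?_
  refine le_degree_of_coeff_pbarPtn_ne_zero fun h => hlam ?_
  rw [map_smul, h, smul_zero]

/-- The coefficients of an expansion in the `p̄'_λ` are unique. -/
theorem pbarPtn_expansion_unique {c c' : Ptn → Polynomial ℚ} {f : Series}
    (h : FormalHasSum (fun lam => c lam • pbarPtn lam) f)
    (h' : FormalHasSum (fun lam => c' lam • pbarPtn lam) f) : c = c' := by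
  classical
  by_contra hne
  have hex : ∃ n, ∃ lam : Ptn, lam.1 = n ∧ c lam ≠ c' lam := by
    obtain ⟨lam, hlam⟩ := Function.ne_iff.1 hne
    exact ⟨_, lam, rfl, hlam⟩
  obtain ⟨lam, hlam, hc⟩ := Nat.find_spec hex
  set n := Nat.find hex
  have hmin : ∀ nu : Ptn, c nu ≠ c' nu → n ≤ nu.1 := fun nu hnu =>
    Nat.find_min' hex ⟨nu, rfl, hnu⟩
  -- In the lowest degree n where c and c' differ, only p̄'_ν with |ν| = n contribute to the
  -- difference, through their leading parts p_ν. The differences thus form a power sum expansion of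
  -- 0.
  set b : Ptn → Polynomial ℚ := fun nu => if nu.1 = n then c nu - c' nu else 0 with hb
  have hb0 : IsPsumExpansion b 0 := by
    refine ⟨formalSummable_psumPtn b, MvPowerSeries.ext fun m => ?_⟩
    rw [map_zero, coeff_formalSum]
    symm
    by_cases hm : m.degree = n
    · have e : MvPowerSeries.coeff m (formalSum fun lam => c lam • pbarPtn lam) =
          MvPowerSeries.coeff m (formalSum fun lam => c' lam • pbarPtn lam) := by
        rw [← h.2, ← h'.2]
      rw [coeff_formalSum, coeff_formalSum] at e
      rw [← sub_eq_zero.2 e, ← finsum_sub_distrib (h.1 m) (h'.1 m)]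
      refine finsum_congr fun nu => ?_
      simp only [hb, map_smul, smul_eq_mul, ← sub_mul]
      split_ifs with hnu
      · rw [(hasLeadingPart_pbarPtn nu).1 m (by omega)]
      · rw [zero_mul]
        by_cases hcn : c nu = c' nu
        · rw [hcn, sub_self, zero_mul]
        · have := hmin nu hcn
          rw [(hasLeadingPart_pbarPtn nu).2 m (by omega), mul_zero]
    · refine finsum_eq_zero_of_forall_eq_zero fun nu => ?_
      rw [map_smul, smul_eq_mul]
      by_cases hnu : nu.1 = n
      · have : MvPowerSeries.coeff m (psumPtn nu) = 0 := by
          by_contra hcon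
          exact hm ((degree_eq_of_coeff_psumPtn_ne_zero hcon).symm.trans hnu)
        rw [this, mul_zero]
      · simp only [hb, if_neg hnu, zero_mul]
  have h00 : IsPsumExpansion (fun _ => 0) 0 := by
    refine ⟨formalSummable_psumPtn _, MvPowerSeries.ext fun m => ?_⟩
    rw [map_zero, coeff_formalSum]
    exact (finsum_eq_zero_of_forall_eq_zero fun nu => by rw [zero_smul, map_zero]).symm
  have := congrFun (isPsumExpansion_unique hb0 h00) lam
  simp only [hb, if_pos hlam] at this
  exact hc (sub_eq_zero.1 this)

/-! ### From power sums to K-theoretic power sums -/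

/-- The positive integers up to `N + 1`. -/
def pnatUpTo (N : ℕ) : Finset ℕ+ :=
  (Finset.range (N + 1)).map ⟨Nat.succPNat, Nat.succPNat_injective⟩

theorem mem_pnatUpTo {N : ℕ} {d : ℕ+} : d ∈ pnatUpTo N ↔ (d : ℕ) ≤ N + 1 := by
  simp only [pnatUpTo, Finset.mem_map, Finset.mem_range, Function.Embedding.coeFn_mk]
  constructor
  · rintro ⟨k, hk, rfl⟩
    rw [Nat.succPNat_coe]
    omega
  · intro h
    exact ⟨d.natPred, by have := d.natPred_add_one; omega, d.succPNat_natPred⟩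

/-- `μ(d) (-1) ^ (n + 1) / (d n)`. -/
def blowUpWeight (d n : ℕ+) : ℚ :=
  (ArithmeticFunction.moebius (d : ℕ) : ℚ) * (-1) ^ ((n : ℕ) + 1) / ((d : ℚ) * (n : ℚ))

theorem coeff_pbar_pow_eq_zero {k j : ℕ} (hk : 0 < k) {m : ℕ →₀ ℕ} (h : m.degree < j * k) :
    MvPowerSeries.coeff m (pbar k ^ j) = 0 := by
  have := (hasLeadingPart_prod_pbar (s := Multiset.replicate j k) fun i hi => by
    rwa [Multiset.eq_of_mem_replicate hi]).2 m (by simpa using h)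
  simpa using this

/-- Insert the logarithm series into the Möbius formula; the n-th power of p̄'_{dk} starts in degree
ndk, so large d and n are invisible. -/
theorem agreeUpTo_psum {k : ℕ} (hk : 0 < k) (N : ℕ) :
    AgreeUpTo N (psum k) (∑ x ∈ pnatUpTo N ×ˢ pnatUpTo N,
      Polynomial.C (blowUpWeight x.1 x.2) • pbar (x.1 * k) ^ (x.2 : ℕ)) := by
  intro m hm
  rw [← moebiusLog_eq_psum hk, moebiusLog, coeff_formalSum, Finset.sum_product, map_sum]
  have hlog : ∀ d : ℕ+, MvPowerSeries.coeff m (logOneAdd (pbar (d * k))) =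
      ∑ n ∈ pnatUpTo N, Polynomial.C ((-1 : ℚ) ^ ((n : ℕ) + 1) / (n : ℚ)) *
        MvPowerSeries.coeff m (pbar (d * k) ^ (n : ℕ)) := by
    intro d
    -- N + 1 terms are taken because `pnatUpTo N` is the shift of `Finset.range (N + 1)`.
    rw [agreeUpTo_logOneAdd (coeff_zero_pbar _) (N + 1) m (by omega), logPartial, map_sum,
      pnatUpTo, Finset.sum_map]
    refine Finset.sum_congr rfl fun j _ => ?_
    simp only [Function.Embedding.coeFn_mk, Nat.succPNat_coe, map_smul, smul_eq_mul]
    congr 3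
    · rw [Nat.succ_eq_add_one, pow_add, pow_add, pow_one]
      ring
    · push_cast
      rfl
  rw [finsum_eq_sum_of_support_subset (s := pnatUpTo N)]
  · refine Finset.sum_congr rfl fun d _ => ?_
    rw [map_smul, hlog, smul_eq_mul, Finset.mul_sum, map_sum]
    refine Finset.sum_congr rfl fun n _ => ?_
    rw [map_smul, smul_eq_mul, ← mul_assoc, ← map_mul, blowUpWeight, div_mul_div_comm]
  · intro d hd
    by_contra hcon
    apply hd
    rw [Finset.mem_coe, mem_pnatUpTo] at hcon
    simp only [map_smul, smul_eq_mul]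
    rw [hlog, Finset.sum_eq_zero, mul_zero]
    intro n _
    rw [coeff_pbar_pow_eq_zero (Nat.mul_pos d.pos hk), mul_zero]
    have h1 : (d : ℕ) ≤ d * k := Nat.le_mul_of_pos_right _ hk
    have h2 : (d : ℕ) * k ≤ n * (d * k) := Nat.le_mul_of_pos_left _ n.pos
    omega

theorem BlowUp.weight_eq (t : BlowUp) : t.weight = ∏ i, blowUpWeight (t.d i) (t.n i) := rfl

theorem BlowUp.prod_parts (t : BlowUp) :
    (t.parts.map pbar).prod = ∏ i, pbar (t.d i * t.ptn.row i) ^ (t.n i : ℕ) := by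
  rw [BlowUp.parts, ← Multiset.coe_mapAddMonoidHom, map_sum, Multiset.prod_sum]
  refine Finset.prod_congr rfl fun i _ => ?_
  rw [Multiset.coe_mapAddMonoidHom, Multiset.map_replicate, Multiset.prod_replicate]

theorem BlowUp.sum_parts (t : BlowUp) :
    t.parts.sum = ∑ i, (t.n i : ℕ) * (t.d i * t.ptn.row i) := by
  rw [BlowUp.parts, Multiset.sum_sum]
  refine Finset.sum_congr rfl fun i _ => ?_
  rw [Multiset.sum_replicate, smul_eq_mul]

theorem BlowUp.parts_pos (t : BlowUp) : ∀ k ∈ t.parts, 0 < k := by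
  intro k hk
  rw [BlowUp.parts, Multiset.mem_sum] at hk
  obtain ⟨i, -, hi⟩ := hk
  rw [Multiset.eq_of_mem_replicate hi]
  exact Nat.mul_pos (t.d i).pos (t.ptn.row_pos i)

/-- The partition `(dλ')ⁿ`. -/
def BlowUp.toPtn (t : BlowUp) : Ptn := ⟨t.parts.sum, ⟨t.parts, fun h => t.parts_pos _ h, rfl⟩⟩

theorem BlowUp.toPtn_eq_iff (t : BlowUp) (lam : Ptn) : t.toPtn = lam ↔ t.parts = lam.2.parts :=
  ⟨fun h => h ▸ rfl, fun h => Ptn.ext_parts h⟩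

/-- All data are positive, so each is bounded by the total size ∑ n_i d_i λ'_i. Only finitely many
blow-ups therefore have a given size. -/
theorem BlowUp.bounds (t : BlowUp) {N : ℕ} (h : t.parts.sum ≤ N) :
    t.ptn.1 ≤ N ∧ ∀ i, (t.d i : ℕ) ≤ N ∧ (t.n i : ℕ) ≤ N := by
  rw [t.sum_parts] at h
  have hrow : ∀ i, t.ptn.row i ≤ (t.n i : ℕ) * (t.d i * t.ptn.row i) := fun i => by
    rw [← mul_assoc]
    exact Nat.le_mul_of_pos_left _ (Nat.mul_pos (t.n i).pos (t.d i).pos)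
  refine ⟨?_, fun i => ?_⟩
  · rw [← t.ptn.sum_row]
    exact (Finset.sum_le_sum fun i _ => hrow i).trans h
  · have hi := (Finset.single_le_sum (f := fun i => (t.n i : ℕ) * (t.d i * t.ptn.row i))
      (fun _ _ => Nat.zero_le _) (Finset.mem_univ i)).trans h
    have hr := t.ptn.row_pos i
    have hd := (t.d i).pos
    have hn := (t.n i).pos
    constructor
    · calc (t.d i : ℕ) ≤ t.d i * t.ptn.row i := Nat.le_mul_of_pos_right _ hr
        _ ≤ t.n i * (t.d i * t.ptn.row i) := Nat.le_mul_of_pos_left _ hn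
        _ ≤ N := hi
    · exact (Nat.le_mul_of_pos_right _ (Nat.mul_pos hd hr)).trans hi

/-- The blow-ups of a fixed partition with multipliers and repetitions up to `N + 1`. -/
def boundedIndices (N : ℕ) (lam : Ptn) : Finset (Fin lam.length → ℕ+ × ℕ+) :=
  Fintype.piFinset fun _ => pnatUpTo N ×ˢ pnatUpTo N

/-- The blow-up with given multipliers and repetitions. -/
def BlowUp.ofIndices (x : Σ lam : Ptn, (Fin lam.length → ℕ+ × ℕ+)) : BlowUp :=
  ⟨x.1, fun i => (x.2 i).1, fun i => (x.2 i).2⟩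

theorem BlowUp.ofIndices_injective : Function.Injective BlowUp.ofIndices := by
  rintro ⟨lam, x⟩ ⟨nu, y⟩ h
  obtain ⟨rfl, h1, h2⟩ := BlowUp.mk.inj h
  congr 1
  funext i
  exact Prod.ext (congrFun (eq_of_heq h1) i) (congrFun (eq_of_heq h2) i)

theorem agreeUpTo_psumPtn (lam : Ptn) (N : ℕ) :
    AgreeUpTo N (psumPtn lam) (∑ x ∈ boundedIndices N lam,
      Polynomial.C (BlowUp.ofIndices ⟨lam, x⟩).weight •
        ((BlowUp.ofIndices ⟨lam, x⟩).parts.map pbar).prod) := by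
  have h := AgreeUpTo.prod Finset.univ fun i (_ : i ∈ Finset.univ) =>
    agreeUpTo_psum (lam.row_pos i) N
  rw [Finset.prod_univ_sum] at h
  refine AgreeUpTo.trans h ?_
  rw [← boundedIndices, Finset.sum_congr rfl fun x _ => ?_]
  · exact AgreeUpTo.refl _
  · rw [BlowUp.prod_parts, BlowUp.weight_eq, map_prod, Finset.prod_smul]
    rfl

/-- Choosing (d_i, n_i) in the expansion of each factor of p_λ' produces a blow-up; the terms are
regrouped by the resulting partition. For a fixed monomial this is a rearrangement of finite sums.
-/
theorem formalHasSum_pbarPtn {a : Ptn → Polynomial ℚ} {f : Series}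
    (h : FormalHasSum (fun lam => a lam • psumPtn lam) f) :
    FormalHasSum (fun lam => (∑ᶠ t ∈ {t : BlowUp | t.parts = lam.2.parts},
      a t.ptn * Polynomial.C t.weight) • pbarPtn lam) f := by
  classical
  refine ⟨formalSummable_pbarPtn _, MvPowerSeries.ext fun m => ?_⟩
  set N := m.degree with hN
  set L := (finite_ptn_le N).toFinset with hL
  have hmemL : ∀ {lam : Ptn}, lam ∈ L ↔ lam.1 ≤ N := by simp [hL]
  set B : Finset BlowUp := (L.sigma (boundedIndices N)).image BlowUp.ofIndices with hB
  have hmemB : ∀ t : BlowUp, t.parts.sum ≤ N → t ∈ B := by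
    intro t ht
    obtain ⟨h1, h2⟩ := t.bounds ht
    rw [hB, Finset.mem_image]
    refine ⟨⟨t.ptn, fun i => (t.d i, t.n i)⟩, ?_, rfl⟩
    rw [Finset.mem_sigma]
    refine ⟨hmemL.2 h1, ?_⟩
    simp only [boundedIndices, Fintype.mem_piFinset, Finset.mem_product, mem_pnatUpTo]
    exact fun i => ⟨(h2 i).1.trans N.le_succ, (h2 i).2.trans N.le_succ⟩
  have hl : MvPowerSeries.coeff m f = ∑ t ∈ B, a t.ptn * Polynomial.C t.weight *
      MvPowerSeries.coeff m (t.parts.map pbar).prod := by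
    rw [h.2, coeff_formalSum, finsum_eq_sum_of_support_subset (s := L), hB,
      Finset.sum_image BlowUp.ofIndices_injective.injOn, Finset.sum_sigma]
    · refine Finset.sum_congr rfl fun lam _ => ?_
      rw [map_smul, agreeUpTo_psumPtn lam N m le_rfl, map_sum, smul_eq_mul, Finset.mul_sum]
      refine Finset.sum_congr rfl fun x _ => ?_
      rw [map_smul, smul_eq_mul, mul_assoc]
      rfl
    · intro lam hlam
      rw [Finset.mem_coe, hmemL]
      refine (degree_eq_of_coeff_psumPtn_ne_zero fun h0 => hlam ?_).le
      simp only [map_smul, h0, smul_zero]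
  -- B also contains blow-ups of size above N; their products have no terms in degree N.
  have hfil : ∑ t ∈ B, a t.ptn * Polynomial.C t.weight *
      MvPowerSeries.coeff m (t.parts.map pbar).prod =
      ∑ t ∈ B with t.parts.sum ≤ N, a t.ptn * Polynomial.C t.weight *
        MvPowerSeries.coeff m (t.parts.map pbar).prod := by
    rw [Finset.sum_filter_of_ne]
    intro t _ ht
    by_contra hcon
    apply ht
    rw [(hasLeadingPart_prod_pbar t.parts_pos).2 m (not_le.1 hcon), mul_zero]
  rw [hl, hfil, coeff_formalSum, finsum_eq_sum_of_support_subset (s := L),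
    ← Finset.sum_fiberwise_of_maps_to (g := BlowUp.toPtn) (t := L)]
  · refine Finset.sum_congr rfl fun lam hlam => ?_
    rw [hmemL] at hlam
    -- The full index set of c_λ lies in B, so the `finsum` is a genuine finite sum and not a
    -- default value.
    have hset : ({t : BlowUp | t.parts = lam.2.parts} : Set BlowUp) =
        (((B.filter fun t => t.parts.sum ≤ N).filter fun t => t.toPtn = lam : Finset BlowUp) :
          Set BlowUp) := by
      ext t
      simp only [Set.mem_ofPred_eq, Finset.coe_filter, Finset.mem_filter, BlowUp.toPtn_eq_iff]
      refine ⟨fun ht => ?_, fun ht => ht.2⟩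
      have hsum : t.parts.sum ≤ N := by rw [ht, lam.2.parts_sum]; exact hlam
      exact ⟨⟨hmemB t hsum, hsum⟩, ht⟩
    rw [hset, finsum_mem_coe_finset, map_smul, smul_eq_mul, Finset.sum_mul]
    refine Finset.sum_congr rfl fun t ht => ?_
    rw [Finset.mem_filter, BlowUp.toPtn_eq_iff] at ht
    rw [ht.2, pbarPtn_eq]
  · intro t ht
    rw [Finset.mem_filter] at ht
    exact hmemL.2 ht.2
  · intro lam hlam
    rw [Finset.mem_coe, hmemL]
    refine le_degree_of_coeff_pbarPtn_ne_zero fun h0 => hlam ?_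
    simp only [map_smul, h0, smul_zero]

end

end Kromatic

theorem proposition5p1 {V : Type*} [Fintype V] [LinearOrder V] (P : PartialOrder V)
    (hP : Kromatic.IsUnitIntervalOrder P) (hnat : Kromatic.IsNaturalLabelling P) :
    Kromatic.IsSymmetricSeries (Kromatic.kromatic (Kromatic.incompGraph P)) ∧
    Kromatic.FormalHasSum
      (fun lam : Kromatic.Ptn =>
        (Polynomial.C (1 / (lam.z : ℚ)) * Kromatic.pyramidSum (Kromatic.incompGraph P) lam) •
          ∏ i, Kromatic.moebiusLog (lam.row i))
      (Kromatic.omega (Kromatic.kromatic (Kromatic.incompGraph P))) ∧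
    ∀ c : Kromatic.Ptn → Polynomial ℚ,
      Kromatic.FormalHasSum (fun lam => c lam • Kromatic.pbarPtn lam)
          (Kromatic.omega (Kromatic.kromatic (Kromatic.incompGraph P))) ↔
        ∀ lam : Kromatic.Ptn,
          c lam = ∑ᶠ t ∈ {t : Kromatic.BlowUp | t.parts = lam.2.parts},
            Polynomial.C (1 / (t.ptn.z : ℚ)) *
              Kromatic.pyramidSum (Kromatic.incompGraph P) t.ptn * Polynomial.C t.weight := by
  have hG := Kromatic.isIntervalLabelling_incompGraph hnat
  have hsum := Kromatic.formalHasSum_omega_kromatic hG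
  have hpbar := Kromatic.formalHasSum_pbarPtn hsum
  refine ⟨Kromatic.isSymmetricSeries_kromatic hG, ?_, fun c => ⟨fun hc lam => ?_, fun hc => ?_⟩⟩
  -- By Möbius inversion the product of logarithms is p_λ, so the claim is the power sum expansion
  -- of ω(X̄_G).
  · have hprod : ∀ lam : Kromatic.Ptn,
        ∏ i, Kromatic.moebiusLog (lam.row i) = Kromatic.psumPtn lam := fun lam =>
      Finset.prod_congr rfl fun i _ => Kromatic.moebiusLog_eq_psum (lam.row_pos i)
    simpa only [hprod] using hsum
  · rw [Kromatic.pbarPtn_expansion_unique hc hpbar]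
  · rwa [funext hc]
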